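/- For $f:[0,\pi/2]\to\mathbb R$ write $\langle f\rangle=\frac2\pi\int_0^{\pi/2}f(\theta)\,d\theta$ and $D_\theta f=\sin(2\theta)\,\partial_\theta f$. For a pair $\Gamma=(\Gamma_1,\Gamma_2)$ of functions of $\theta\in[0,\pi/2]$ let $$L_\theta\Gamma=\Big(2D_\theta\Gamma_1+6\Gamma_1-\Gamma_2,\ \ 2D_\theta\Gamma_2+9\Gamma_2-130\cos^2\theta\,\big(\Gamma_1-\langle\Gamma_1\rangle\big)\Big).$$ Let $\Gamma^*=(\Gamma^*_1,\Gamma^*_2)$ be the profile, i.e. the solution of $L_\theta\Gamma^*=0$ with $\langle\Gamma^*_1\rangle=2$ that is continuous on $[0,\pi/2]$ and $C^1$ on $(0,\pi/2)$. Let $$F^*=\Big(D_\theta\Gamma^*_1+\tfrac52\Gamma^*_1,\ D_\theta\Gamma^*_2+4\Gamma^*_2\Big),\qquad \mathcal L\Gamma=L_\theta\Gamma+\frac{\Gamma^*}{2}\langle\Gamma_1\rangle .$$ For $A\in\{L_\theta,\mathcal L\}$, $\exp(-tA)F^*$ denotes the solution $u$ of $\partial_tu+Au=0$ for $t>0$,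 $\theta\in(0,\pi/2)$, with $u(0)=F^*$, that is continuous on $[0,\infty)\times[0,\pi/2]$ and $C^1$ on $(0,\infty)\times(0,\pi/2)$. Put $\Theta(t)=\exp(-tL_\theta)F^*$, and let $\Upsilon(t)$ be the first component of $\langle\exp(-t\mathcal L)F^*\rangle$, equivalently $$\Upsilon(t)=\langle\Theta_1(t)\rangle-\int_0^te^{-t+s}\,\langle\Theta_1(s)\rangle\,ds,$$ which is the inverse Laplace transform of $\frac{\xi}{1+\xi}\langle\hat\Theta_1(\xi)\rangle$. Then $\Upsilon(t)>0$ for all $t\in[0,\log 4]$ (for each of the two expressions for $\Upsilon$). -/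

import Mathlib

open Real Set

/-- The angular average `(2/π) ∫₀^{π/2} f(θ) dθ`. -/
noncomputable def angAvg (f : ℝ → ℝ) : ℝ :=
  (2 / π) * ∫ θ in (0 : ℝ)..(π / 2), f θ

/-- The degenerate angular derivative `D_θ f = sin(2θ) ∂_θ f`. -/
noncomputable def angD (f : ℝ → ℝ) (θ : ℝ) : ℝ :=
  sin (2 * θ) * deriv f θ

/-- The angular operator `L_θ`, acting on pairs `Γ = (Γ₁, Γ₂)` of functions of `θ`:
`L_θ Γ = (2 D_θ Γ₁ + 6 Γ₁ - Γ₂, 2 D_θ Γ₂ + 9 Γ₂ - 130 cos²θ (Γ₁ - avg Γ₁))`. -/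
noncomputable def opLθ (Γ : ℝ → ℝ × ℝ) (θ : ℝ) : ℝ × ℝ :=
  (2 * angD (fun x => (Γ x).1) θ + 6 * (Γ θ).1 - (Γ θ).2,
   2 * angD (fun x => (Γ x).2) θ + 9 * (Γ θ).2
     - 130 * cos θ ^ 2 * ((Γ θ).1 - angAvg (fun x => (Γ x).1)))

/-- `G` is the angular profile: `L_θ G = 0` with `avg G₁ = 2`. A solution that is continuous on
`[0, π/2]` and `C¹` inside is unique; no smoothness at `π/2` is available. -/
structure IsAngularProfile (G : ℝ → ℝ × ℝ) : Prop where
  continuousOn : ContinuousOn G (Icc 0 (π / 2))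
  contDiffOn : ContDiffOn ℝ 1 G (Ioo 0 (π / 2))
  eqn : ∀ θ ∈ Ioo 0 (π / 2), opLθ G θ = 0
  avg_eq : angAvg (fun θ => (G θ).1) = 2

/-- `F = (D_θ G₁ + (5/2) G₁, D_θ G₂ + 4 G₂)`. -/
noncomputable def angF (G : ℝ → ℝ × ℝ) (θ : ℝ) : ℝ × ℝ :=
  (angD (fun x => (G x).1) θ + 5 / 2 * (G θ).1,
   angD (fun x => (G x).2) θ + 4 * (G θ).2)

/-- The operator `Γ ↦ L_θ Γ + (G / 2) avg Γ₁`, where `G` is the angular profile. -/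
noncomputable def opL (G : ℝ → ℝ × ℝ) (Γ : ℝ → ℝ × ℝ) (θ : ℝ) : ℝ × ℝ :=
  opLθ Γ θ + (angAvg (fun x => (Γ x).1) / 2) • G θ

/-- `u(t) = exp(-t A) F`: `u` is the classical solution on `[0, ∞) × [0, π/2]` of
`∂_t u + A u = 0` with `u(0) = F`. The first argument of `u` is `t`, the second is `θ`. -/
structure IsOrbit (A : (ℝ → ℝ × ℝ) → ℝ → ℝ × ℝ) (F : ℝ → ℝ × ℝ) (u : ℝ → ℝ → ℝ × ℝ) : Prop where
  continuousOn : ContinuousOn (fun p : ℝ × ℝ => u p.1 p.2) (Ici 0 ×ˢ Icc 0 (π / 2))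
  contDiffOn : ContDiffOn ℝ 1 (fun p : ℝ × ℝ => u p.1 p.2) (Ioi 0 ×ˢ Ioo 0 (π / 2))
  initial : ∀ θ ∈ Ioo 0 (π / 2), u 0 θ = F θ
  eqn : ∀ t > 0, ∀ θ ∈ Ioo 0 (π / 2), HasDerivAt (fun s => u s θ) (-A (u t) θ) t

/-! Write G for the profile, P = e^t Θ, m = ⟨P₁⟩, A = ∫₀ᵗ m and K = ∫₀ᵗ P. The claim becomes Y = m −
A > 0. The pair (p, q) = P − P(0) − 5K + 2A G starts from zero, satisfies ⟨p⟩ = Y − Y(0), and solves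
a local cooperative transport system: the nonlocal term survives only through the forcing 2Y (G₁, G₂
− 65 cos² θ), next to a time-independent source. Lower barriers for p therefore give lower bounds
for Y by a comparison principle (`nonneg_of_transport_system`).

The barriers stay bounded in time because of the structure at θ = 0. There the zeroth-order matrix
with rows (5, −1), (−130, 8) has eigenvalues 18 and −5, and both the forcing and the source are
multiples of (1, −13), the eigenvector of 18. The growing mode e^{5t} is thus not excited, and the
response to a forcing of size M is at most M/18 in amplitude. Away from θ = 0 the remainder, which
vanishes there, is absorbed by explicit polynomials in w = sin² θ; this is `IsTrapped.evolve`.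

Suppose Y first vanishes at T, and let M = Y(τ) be its maximum on [0, T]. With σ = T − τ, the
barrier controls (p, q) on [0, σ]; then it controls the increments p(t + σ) − p(t) on [0, τ], which
are source-free and forced by Y(t + σ) − Y(t) ∈ [−M, M]. At t = τ, averaging gives Y(T) − Y(τ) ≥
−(22M + 2)/25. The left side is at most −M, so M ≤ 2/3, against Y(0) ≥ 2
(`pos_of_forced_evolution`).

The profile enters through the polynomial bounds of `IsAngularProfile.enclosure`. For L_θ the matrix
at θ = 0 has eigenvalues 19 and −4, and the latter admits a continuous mode behaving like tan θ. The
condition ⟨G₁⟩ = 2 excludes it, through `IsAngularProfile.first_integral`. The statement for 𝓛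
reduces to that for L_θ by adding a time-dependent multiple of G, since L_θ G = 0. -/

/-! ### Comparison principle for degenerate cooperative transport -/

theorem deriv_nonpos_of_left_nonneg {f : ℝ → ℝ} {t p : ℝ} (ht : 0 < t) (h : HasDerivAt f p t)
    (h0 : f t = 0) (hf : ∀ s ∈ Ico 0 t, 0 ≤ f s) : p ≤ 0 := by
  by_contra! hp
  have h1 := (hasDerivAt_iff_tendsto_slope_left_right.1 h).1
  have h2 : ∀ᶠ s in nhdsWithin t (Iio t), 0 < slope f t s := h1.eventually (lt_mem_nhds hp)
  have h3 : ∀ᶠ s in nhdsWithin t (Iio t), s ∈ Ico 0 t := by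
    filter_upwards [Ioo_mem_nhdsLT ht] with s hs using ⟨hs.1.le, hs.2⟩
  obtain ⟨s, hs1, hs2⟩ := (h2.and h3).exists
  rw [slope_def_field, h0, sub_zero] at hs1
  exact absurd hs1 (not_lt.2 (div_nonpos_of_nonneg_of_nonpos (hf s hs2) (by linarith [hs2.2])))

theorem sin_two_mul_pos {θ : ℝ} (h : θ ∈ Ioo 0 (π / 2)) : 0 < sin (2 * θ) :=
  sin_pos_of_pos_of_lt_pi (by linarith [h.1]) (by linarith [h.2])

theorem hasDerivAt_inv_sin_two_mul {θ : ℝ} (h : θ ∈ Ioo 0 (π / 2)) :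
    HasDerivAt (fun x => (sin (2 * x))⁻¹) (-(2 * cos (2 * θ)) / sin (2 * θ) ^ 2) θ := by
  have h1 : HasDerivAt (fun x => sin (2 * x)) (2 * cos (2 * θ)) θ := by
    have := (hasDerivAt_sin (2 * θ)).comp θ ((hasDerivAt_id θ).const_mul 2)
    simpa [mul_comm, Function.comp_def] using this
  exact h1.inv (sin_two_mul_pos h).ne'

/-- At a first touching point of the perturbed solution, the differential inequality fails. -/
theorem no_touching {a : ℝ → ℝ → ℝ} {t θ ε K α β b : ℝ} (hε : 0 < ε) (ht : 0 < t)
    (hθ : θ ∈ Ioo 0 (π / 2)) (hK : 4 - α + β < K) (hβ : 0 ≤ β)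
    (hpde : ∃ p q, HasDerivAt (fun s => a s θ) p t ∧ HasDerivAt (a t) q θ ∧
      0 ≤ p + 2 * sin (2 * θ) * q + α * a t θ - β * b)
    (hb : 0 ≤ b + ε * (exp (K * t) * (sin (2 * θ))⁻¹))
    (h0 : a t θ + ε * (exp (K * t) * (sin (2 * θ))⁻¹) = 0)
    (hleft : ∀ s ∈ Ico 0 t, 0 ≤ a s θ + ε * (exp (K * s) * (sin (2 * θ))⁻¹))
    (hspace : ∀ x ∈ Ioo 0 (π / 2), 0 ≤ a t x + ε * (exp (K * t) * (sin (2 * x))⁻¹)) : False := by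
  obtain ⟨p, q, hp, hq, hpq⟩ := hpde
  have hs := sin_two_mul_pos hθ
  have hE : HasDerivAt (fun s => exp (K * s)) (exp (K * t) * K) t := by
    have := ((hasDerivAt_id t).const_mul K).exp
    simpa using this
  have h1 := deriv_nonpos_of_left_nonneg ht
    (hp.add ((hE.mul_const (sin (2 * θ))⁻¹).const_mul ε)) h0 hleft
  have h2 := hq.add (((hasDerivAt_inv_sin_two_mul hθ).const_mul (exp (K * t))).const_mul ε)
  have hmin : IsLocalMin (a t + fun x => ε * (exp (K * t) * (sin (2 * x))⁻¹)) θ := by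
    filter_upwards [isOpen_Ioo.mem_nhds hθ] with x hx
    simp only [Pi.add_apply]
    rw [h0]
    exact hspace x hx
  have h3 := hmin.hasDerivAt_eq_zero h2
  set H := (sin (2 * θ))⁻¹ with hH
  have hHs : sin (2 * θ) * H = 1 := mul_inv_cancel₀ hs.ne'
  have hHpos : 0 < H := inv_pos.2 hs
  set E := exp (K * t) with hEdef
  have hEpos : 0 < E := exp_pos _
  have h4 : q = ε * E * (2 * cos (2 * θ)) * H ^ 2 := by
    have : -(2 * cos (2 * θ)) / sin (2 * θ) ^ 2 = -(2 * cos (2 * θ)) * H ^ 2 := by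
      rw [hH, inv_pow]; rfl
    rw [this] at h3
    linarith
  -- Stationarity in θ determines q. The transport field applied to 1 / sin 2θ gives −4 cos 2θ / sin
  -- 2θ, which is the source of the 4 in `hK`.
  have h5 : 2 * sin (2 * θ) * q = ε * E * H * (4 * cos (2 * θ)) := by
    rw [h4]
    linear_combination (4 * ε * E * cos (2 * θ) * H) * hHs
  have hpos : 0 < ε * E * H := by positivity
  have h6 : ε * E * H * (4 * cos (2 * θ)) ≤ ε * E * H * 4 :=
    mul_le_mul_of_nonneg_left (by linarith [cos_le_one (2 * θ)]) hpos.le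
  have h7 : 0 ≤ β * (b + ε * (E * H)) := mul_nonneg hβ hb
  have h8 : ε * E * H * (4 - α + β) < ε * E * H * K := mul_lt_mul_of_pos_left hK hpos
  have h9 : a t θ = -(ε * E * H) := by linarith
  rw [h5, h9] at hpq
  have h10 : p ≤ -(ε * E * H * K) := by
    have : ε * (E * K * H) = ε * E * H * K := by ring
    linarith
  have h11 : β * (b + ε * (E * H)) = β * b + ε * E * H * β := by ring
  have h12 : ε * E * H * (4 - α + β) = ε * E * H * 4 - α * (ε * E * H) + ε * E * H * β := by ring
  have h13 : α * -(ε * E * H) = - (α * (ε * E * H)) := by ring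
  linarith

/-- Comparison principle for a cooperative pair of degenerate transport inequalities. -/
theorem nonneg_of_transport_system {T B α₁ α₂ Λ : ℝ} {β₁ β₂ : ℝ → ℝ}
    (hβ₁ : ∀ θ, 0 ≤ β₁ θ ∧ β₁ θ ≤ Λ) (hβ₂ : ∀ θ, 0 ≤ β₂ θ ∧ β₂ θ ≤ Λ) {a b : ℝ → ℝ → ℝ}
    (ha : ContinuousOn (fun p : ℝ × ℝ => a p.1 p.2) (Icc 0 T ×ˢ Ioo 0 (π / 2)))
    (hb : ContinuousOn (fun p : ℝ × ℝ => b p.1 p.2) (Icc 0 T ×ˢ Ioo 0 (π / 2)))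
    (hBa : ∀ t ∈ Icc 0 T, ∀ θ ∈ Ioo 0 (π / 2), -B ≤ a t θ)
    (hBb : ∀ t ∈ Icc 0 T, ∀ θ ∈ Ioo 0 (π / 2), -B ≤ b t θ)
    (ha0 : ∀ θ ∈ Ioo 0 (π / 2), 0 ≤ a 0 θ) (hb0 : ∀ θ ∈ Ioo 0 (π / 2), 0 ≤ b 0 θ)
    (hpa : ∀ t ∈ Ioc 0 T, ∀ θ ∈ Ioo 0 (π / 2), ∃ p q, HasDerivAt (fun s => a s θ) p t ∧
      HasDerivAt (a t) q θ ∧ 0 ≤ p + 2 * sin (2 * θ) * q + α₁ * a t θ - β₁ θ * b t θ)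
    (hpb : ∀ t ∈ Ioc 0 T, ∀ θ ∈ Ioo 0 (π / 2), ∃ p q, HasDerivAt (fun s => b s θ) p t ∧
      HasDerivAt (b t) q θ ∧ 0 ≤ p + 2 * sin (2 * θ) * q + α₂ * b t θ - β₂ θ * a t θ) :
    ∀ t ∈ Icc 0 T, ∀ θ ∈ Ioo 0 (π / 2), 0 ≤ a t θ ∧ 0 ≤ b t θ := by
  set K : ℝ := |α₁| + |α₂| + |Λ| + 5 with hKdef
  have hK₁ : ∀ θ, 4 - α₁ + β₁ θ < K := fun θ => by
    linarith [neg_abs_le α₁, abs_nonneg α₂, le_abs_self Λ, (hβ₁ θ).2]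
  have hK₂ : ∀ θ, 4 - α₂ + β₂ θ < K := fun θ => by
    linarith [neg_abs_le α₂, abs_nonneg α₁, le_abs_self Λ, (hβ₂ θ).2]
  have hK0 : 0 ≤ K := by positivity
  have key : ∀ ε > 0, ∀ t ∈ Icc 0 T, ∀ θ ∈ Ioo 0 (π / 2),
      0 < min (a t θ + ε * (exp (K * t) * (sin (2 * θ))⁻¹))
        (b t θ + ε * (exp (K * t) * (sin (2 * θ))⁻¹)) := by
    intro ε hε
    set f : ℝ × ℝ → ℝ := fun p => min (a p.1 p.2 + ε * (exp (K * p.1) * (sin (2 * p.2))⁻¹))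
        (b p.1 p.2 + ε * (exp (K * p.1) * (sin (2 * p.2))⁻¹)) with hf
    by_contra! hcon
    obtain ⟨t₀, ht₀, θ₀, hθ₀, hneg⟩ := hcon
    set B' := max B 1 with hB'
    have hB'pos : 0 < B' := lt_of_lt_of_le one_pos (le_max_right _ _)
    -- Since a and b are at least −B and the perturbation is at least ε / sin 2θ, `f` can be
    -- nonpositive only on this compact set, away from both endpoints. This replaces boundary
    -- conditions.
    set C : Set (ℝ × ℝ) := Icc 0 T ×ˢ (Icc 0 (π / 2) ∩ {θ | ε / B' ≤ sin (2 * θ)}) with hC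
    have hclosed : IsClosed {θ : ℝ | ε / B' ≤ sin (2 * θ)} :=
      isClosed_le continuous_const (by fun_prop)
    have hCcomp : IsCompact C := isCompact_Icc.prod (isCompact_Icc.inter_right hclosed)
    have hCsub : C ⊆ Icc 0 T ×ˢ Ioo 0 (π / 2) := by
      rintro ⟨t, θ⟩ ⟨h1, h2, h3⟩
      have hpos : 0 < sin (2 * θ) := lt_of_lt_of_le (div_pos hε hB'pos) h3
      refine ⟨h1, lt_of_le_of_ne h2.1 ?_, lt_of_le_of_ne h2.2 ?_⟩
      · rintro h
        simp only at h
        rw [← h] at hpos; simp at hpos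
      · rintro h
        simp only at h
        rw [h, mul_div_cancel₀ _ (two_ne_zero), sin_pi] at hpos
        exact lt_irrefl _ hpos
    have hcontE : ContinuousOn (fun p : ℝ × ℝ => ε * (exp (K * p.1) * (sin (2 * p.2))⁻¹))
        (Icc 0 T ×ˢ Ioo 0 (π / 2)) := by
      refine continuousOn_const.mul (ContinuousOn.mul (by fun_prop) ?_)
      refine ContinuousOn.inv₀ (by fun_prop) ?_
      rintro ⟨t, θ⟩ ⟨-, h⟩
      exact (sin_two_mul_pos h).ne'
    have hfc : ContinuousOn f (Icc 0 T ×ˢ Ioo 0 (π / 2)) :=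
      ContinuousOn.inf (ha.add hcontE) (hb.add hcontE)
    have hmemC : ∀ t ∈ Icc 0 T, ∀ θ ∈ Ioo 0 (π / 2), f (t, θ) ≤ 0 → (t, θ) ∈ C := by
      intro t ht θ hθ h
      refine ⟨ht, ⟨hθ.1.le, hθ.2.le⟩, ?_⟩
      have hs := sin_two_mul_pos hθ
      have hE1 : 1 ≤ exp (K * t) := one_le_exp (mul_nonneg hK0 ht.1)
      have h1 : ε * (sin (2 * θ))⁻¹ ≤ ε * (exp (K * t) * (sin (2 * θ))⁻¹) :=
        mul_le_mul_of_nonneg_left (le_mul_of_one_le_left (inv_pos.2 hs).le hE1) hε.le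
      have h2 : ε * (sin (2 * θ))⁻¹ ≤ B' := by
        rcases min_le_iff.1 h with h | h
        · simp only at h; linarith [hBa t ht θ hθ, le_max_left B 1]
        · simp only at h; linarith [hBb t ht θ hθ, le_max_left B 1]
      rw [mem_ofPred_eq]
      rw [div_le_iff₀ hB'pos]
      rw [← div_eq_mul_inv, div_le_iff₀ hs] at h2
      linarith
    have hScomp : IsCompact (C ∩ f ⁻¹' Iic 0) :=
      hCcomp.of_isClosed_subset
        ((hfc.mono hCsub).preimage_isClosed_of_isClosed hCcomp.isClosed isClosed_Iic)
        inter_subset_left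
    have hne : (C ∩ f ⁻¹' Iic 0).Nonempty := ⟨(t₀, θ₀), hmemC t₀ ht₀ θ₀ hθ₀ hneg, hneg⟩
    -- The earliest time at which `f` is nonpositive: a first touching point for one of the two
    -- components.
    obtain ⟨⟨t, θ⟩, ⟨hmC, hmf⟩, hmin⟩ := hScomp.exists_isMinOn hne continuous_fst.continuousOn
    have hmin' : ∀ s ∈ Icc 0 T, s < t → ∀ x ∈ Ioo 0 (π / 2), 0 < f (s, x) := by
      intro s hs hst x hx
      by_contra! h
      exact absurd (hmin ⟨hmemC s hs x hx h, h⟩) (not_le.2 hst)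
    obtain ⟨ht, hθ⟩ := hCsub hmC
    simp only at ht hθ
    have ht0 : 0 < t := by
      rcases ht.1.eq_or_lt with h | h
      · exfalso
        have hs := sin_two_mul_pos hθ
        have : 0 < ε * (exp (K * t) * (sin (2 * θ))⁻¹) := by positivity
        have h0 : 0 < f (t, θ) := by
          refine lt_min ?_ ?_
          · have := ha0 θ hθ; rw [h] at this; simp only; linarith
          · have := hb0 θ hθ; rw [h] at this; simp only; linarith
        exact absurd hmf (not_le.2 h0)
      · exact h
    have hnonneg : ∀ x ∈ Ioo 0 (π / 2), 0 ≤ f (t, x) := by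
      intro x hx
      have hc : ContinuousWithinAt (fun s => f (s, x)) (Ico 0 t) t := by
        have h1 : ContinuousWithinAt f (Icc 0 T ×ˢ Ioo 0 (π / 2)) (t, x) := hfc _ ⟨ht, hx⟩
        refine ContinuousWithinAt.comp (t := Icc 0 T ×ˢ Ioo 0 (π / 2)) (f := fun s => (s, x)) h1
          (by fun_prop) ?_
        intro s hs
        exact ⟨⟨hs.1, hs.2.le.trans ht.2⟩, hx⟩
      have : t ∈ closure (Ico 0 t) := by
        rw [closure_Ico ht0.ne]; exact ⟨ht0.le, le_rfl⟩
      have hnb : (nhdsWithin t (Ico 0 t)).NeBot := mem_closure_iff_nhdsWithin_neBot.1 this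
      refine ge_of_tendsto hc ?_
      filter_upwards [self_mem_nhdsWithin] with s hs
      exact (hmin' s ⟨hs.1, hs.2.le.trans ht.2⟩ hs.2 x hx).le
    have hz : f (t, θ) = 0 := le_antisymm hmf (hnonneg θ hθ)
    have hleft : ∀ s ∈ Ico 0 t, 0 ≤ f (s, θ) := fun s hs =>
      (hmin' s ⟨hs.1, hs.2.le.trans ht.2⟩ hs.2 θ hθ).le
    have hza : ∀ x ∈ Ioo 0 (π / 2), 0 ≤ a t x + ε * (exp (K * t) * (sin (2 * x))⁻¹) :=
      fun x hx => (hnonneg x hx).trans (min_le_left _ _)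
    have hzb : ∀ x ∈ Ioo 0 (π / 2), 0 ≤ b t x + ε * (exp (K * t) * (sin (2 * x))⁻¹) :=
      fun x hx => (hnonneg x hx).trans (min_le_right _ _)
    rcases min_choice (a t θ + ε * (exp (K * t) * (sin (2 * θ))⁻¹))
        (b t θ + ε * (exp (K * t) * (sin (2 * θ))⁻¹)) with h | h
    · exact no_touching hε ht0 hθ (hK₁ θ) (hβ₁ θ).1 (hpa t ⟨ht0, ht.2⟩ θ hθ) (hzb θ hθ)
        (h.symm.trans hz) (fun s hs => (hleft s hs).trans (min_le_left _ _)) hza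
    · exact no_touching hε ht0 hθ (hK₂ θ) (hβ₂ θ).1 (hpb t ⟨ht0, ht.2⟩ θ hθ) (hza θ hθ)
        (h.symm.trans hz) (fun s hs => (hleft s hs).trans (min_le_right _ _)) hzb
  intro t ht θ hθ
  have hs := sin_two_mul_pos hθ
  set D := exp (K * t) * (sin (2 * θ))⁻¹ with hD
  have hDpos : 0 < D := by positivity
  constructor
  · refine le_of_forall_pos_le_add fun δ hδ => ?_
    have h1 := (key (δ / D) (by positivity) t ht θ hθ).trans_le (min_le_left _ _)
    rw [← hD, div_mul_cancel₀ _ hDpos.ne'] at h1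
    exact h1.le
  · refine le_of_forall_pos_le_add fun δ hδ => ?_
    have h1 := (key (δ / D) (by positivity) t ht θ hθ).trans_le (min_le_right _ _)
    rw [← hD, div_mul_cancel₀ _ hDpos.ne'] at h1
    exact h1.le

/-! ### Primitives and the weight tan² θ -/

theorem hasDerivAt_primitive {f : ℝ → ℝ} {a b x : ℝ} (hf : ContinuousOn f (Icc a b))
    (hx : x ∈ Ioo a b) : HasDerivAt (fun y => ∫ s in a..y, f s) (f x) x := by
  have hn : Icc a b ∈ nhds x := Icc_mem_nhds hx.1 hx.2
  refine intervalIntegral.integral_hasDerivAt_right ?_ ?_ (hf.continuousAt hn)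
  · refine (hf.mono ?_).intervalIntegrable
    rw [uIcc_of_le hx.1.le]
    exact Icc_subset_Icc_right hx.2.le
  · exact (hf.mono Ioo_subset_Icc_self).stronglyMeasurableAtFilter isOpen_Ioo x hx

theorem continuousOn_primitive_Icc {f : ℝ → ℝ} {a b : ℝ} (hab : a ≤ b)
    (hf : ContinuousOn f (Icc a b)) :
    ContinuousOn (fun y => ∫ s in a..y, f s) (Icc a b) := by
  have := intervalIntegral.continuousOn_primitive_interval' (μ := MeasureTheory.volume)
    (f := f) (a := a) (b₁ := a) (b₂ := b)
    ((hf.mono (by rw [uIcc_of_le hab])).intervalIntegrable) left_mem_uIcc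
  rwa [uIcc_of_le hab] at this

theorem hasDerivAt_tan_sq {θ : ℝ} (h : θ ∈ Ioo 0 (π / 2)) :
    HasDerivAt (fun x => tan x ^ 2) (2 * tan θ / cos θ ^ 2) θ := by
  have hc : cos θ ≠ 0 := (cos_pos_of_mem_Ioo ⟨by linarith [h.1, pi_pos], h.2⟩).ne'
  have := (hasDerivAt_tan hc).pow 2
  refine this.congr_deriv ?_
  simp; ring

theorem two_sin_mul_deriv_tan_sq {θ : ℝ} (h : θ ∈ Ioo 0 (π / 2)) :
    2 * sin (2 * θ) * (2 * tan θ / cos θ ^ 2) = 8 * tan θ ^ 2 := by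
  have hc : cos θ ≠ 0 := (cos_pos_of_mem_Ioo ⟨by linarith [h.1, pi_pos], h.2⟩).ne'
  rw [sin_two_mul, tan_eq_sin_div_cos]
  field_simp
  ring

theorem continuousOn_tan_sq : ContinuousOn (fun x => tan x ^ 2) (Ioo 0 (π / 2)) :=
  fun _ h => (hasDerivAt_tan_sq h).continuousAt.continuousWithinAt

/-! ### Stationary comparison as a large-time limit -/

theorem tendsto_add_mul_exp_neg (d K k : ℝ) (hk : 0 < k) :
    Filter.Tendsto (fun t => d + K * exp (-(k * t))) Filter.atTop (nhds d) := by
  have h : Filter.Tendsto (fun t : ℝ => exp (-(k * t))) Filter.atTop (nhds 0) :=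
    tendsto_exp_neg_atTop_nhds_zero.comp (Filter.tendsto_id.const_mul_atTop hk)
  simpa using (h.const_mul K).const_add d

/-- The function f + |B| e^{−19t} is an evolution supersolution that starts nonnegative; comparison
holds on every time interval, and t → ∞ removes the added term. -/
theorem nonneg_of_stationary_scalar {f f' : ℝ → ℝ} {B : ℝ}
    (hB : ∀ θ ∈ Ioo 0 (π / 2), -B ≤ f θ)
    (hf : ∀ θ ∈ Ioo 0 (π / 2), HasDerivAt f (f' θ) θ)
    (h : ∀ θ ∈ Ioo 0 (π / 2), 0 ≤ 2 * sin (2 * θ) * f' θ + 19 * f θ) :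
    ∀ θ ∈ Ioo 0 (π / 2), 0 ≤ f θ := by
  have hB' : ∀ θ ∈ Ioo 0 (π / 2), -|B| ≤ f θ := fun θ hθ =>
    (neg_le_neg (le_abs_self B)).trans (hB θ hθ)
  have hc : ContinuousOn f (Ioo 0 (π / 2)) := fun θ hθ =>
    (hf θ hθ).continuousAt.continuousWithinAt
  have key : ∀ T : ℝ, ∀ t ∈ Icc 0 T, ∀ θ ∈ Ioo 0 (π / 2), 0 ≤ f θ + |B| * exp (-(19 * t)) := by
    intro T
    set a : ℝ → ℝ → ℝ := fun t θ => f θ + |B| * exp (-(19 * t)) with ha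
    have hcont : ContinuousOn (fun p : ℝ × ℝ => a p.1 p.2) (Icc 0 T ×ˢ Ioo 0 (π / 2)) := by
      refine ContinuousOn.add (hc.comp continuousOn_snd fun p hp => hp.2) (by fun_prop)
    have hlow : ∀ t ∈ Icc 0 T, ∀ θ ∈ Ioo 0 (π / 2), -|B| ≤ a t θ := fun t _ θ hθ => by
      have : 0 ≤ |B| * exp (-(19 * t)) := by positivity
      simp only [ha]; linarith [hB' θ hθ]
    have h0 : ∀ θ ∈ Ioo 0 (π / 2), 0 ≤ a 0 θ := fun θ hθ => by
      simp only [ha, mul_zero, neg_zero, exp_zero, mul_one]; linarith [hB' θ hθ]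
    have hp : ∀ t ∈ Ioc 0 T, ∀ θ ∈ Ioo 0 (π / 2), ∃ p q, HasDerivAt (fun s => a s θ) p t ∧
        HasDerivAt (a t) q θ ∧ 0 ≤ p + 2 * sin (2 * θ) * q + 19 * a t θ - 0 * a t θ := by
      intro t _ θ hθ
      refine ⟨|B| * (exp (-(19 * t)) * -19), f' θ, ?_, ?_, ?_⟩
      · have hE : HasDerivAt (fun s => exp (-(19 * s))) (exp (-(19 * t)) * -19) t := by
          simpa using ((hasDerivAt_id t).const_mul (19 : ℝ)).neg.exp
        exact (hE.const_mul |B|).const_add (f θ)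
      · exact (hf θ hθ).add_const _
      · have := h θ hθ
        simp only [ha]; nlinarith
    intro t ht θ hθ
    exact (nonneg_of_transport_system (β₁ := fun _ => 0) (β₂ := fun _ => 0) (Λ := 0)
      (fun _ => ⟨le_rfl, le_rfl⟩) (fun _ => ⟨le_rfl, le_rfl⟩) hcont hcont hlow hlow h0 h0 hp hp
      t ht θ hθ).1
  intro θ hθ
  refine ge_of_tendsto (tendsto_add_mul_exp_neg (f θ) |B| 19 (by norm_num)) ?_
  filter_upwards [Filter.eventually_ge_atTop 0] with t ht
  exact key t t ⟨ht, le_rfl⟩ θ hθ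

/-- The zeroth-order matrix at θ = 0 has the negative eigenvalue −4, so boundedness alone does not
suffice: ± tan θ times its eigenvector would compete. Lower bounds of order tan² θ exclude this
mode, because on tan² θ the transport term gains 8, which outweighs the −4 and leaves exponential
decay. -/
theorem nonneg_of_stationary_system {a b a' b' : ℝ → ℝ} {B K : ℝ}
    (hBa : ∀ θ ∈ Ioo 0 (π / 2), -B ≤ a θ) (hBb : ∀ θ ∈ Ioo 0 (π / 2), -B ≤ b θ)
    (hKa : ∀ θ ∈ Ioo 0 (π / 2), -(K * tan θ ^ 2) ≤ a θ)
    (hKb : ∀ θ ∈ Ioo 0 (π / 2), -(K * tan θ ^ 2) ≤ b θ)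
    (hda : ∀ θ ∈ Ioo 0 (π / 2), HasDerivAt a (a' θ) θ)
    (hdb : ∀ θ ∈ Ioo 0 (π / 2), HasDerivAt b (b' θ) θ)
    (ha : ∀ θ ∈ Ioo 0 (π / 2), 0 ≤ 2 * sin (2 * θ) * a' θ + 6 * a θ - b θ)
    (hb : ∀ θ ∈ Ioo 0 (π / 2),
      0 ≤ 2 * sin (2 * θ) * b' θ + 9 * b θ - 130 * cos θ ^ 2 * a θ) :
    ∀ θ ∈ Ioo 0 (π / 2), 0 ≤ a θ ∧ 0 ≤ b θ := by
  have hKa' : ∀ θ ∈ Ioo 0 (π / 2), -(|K| * tan θ ^ 2) ≤ a θ := fun θ hθ => by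
    nlinarith [hKa θ hθ, le_abs_self K, sq_nonneg (tan θ)]
  have hKb' : ∀ θ ∈ Ioo 0 (π / 2), -(|K| * tan θ ^ 2) ≤ b θ := fun θ hθ => by
    nlinarith [hKb θ hθ, le_abs_self K, sq_nonneg (tan θ)]
  have hE : ∀ t : ℝ, HasDerivAt (fun s => exp (-(1 * s))) (-exp (-(1 * t))) t := fun t => by
    simpa using ((hasDerivAt_id t).const_mul (1 : ℝ)).neg.exp
  have hca : ContinuousOn a (Ioo 0 (π / 2)) := fun θ hθ =>
    (hda θ hθ).continuousAt.continuousWithinAt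
  have hcb : ContinuousOn b (Ioo 0 (π / 2)) := fun θ hθ =>
    (hdb θ hθ).continuousAt.continuousWithinAt
  have hcE : ∀ T c : ℝ, ContinuousOn (fun p : ℝ × ℝ => c * tan p.2 ^ 2 * exp (-(1 * p.1)))
      (Icc 0 T ×ˢ Ioo 0 (π / 2)) := fun T c => by
    refine ContinuousOn.mul (continuousOn_const.mul ?_) (by fun_prop)
    exact continuousOn_tan_sq.comp continuousOn_snd fun p hp => hp.2
  have key : ∀ T : ℝ, ∀ t ∈ Icc 0 T, ∀ θ ∈ Ioo 0 (π / 2),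
      0 ≤ a θ + |K| * tan θ ^ 2 * exp (-(1 * t)) ∧
      0 ≤ b θ + 13 * |K| * tan θ ^ 2 * exp (-(1 * t)) := by
    intro T
    -- The weights (1, 13) make tan² θ e^{−t} a supersolution: the first row gives 8 + 6 − 13 − 1 =
    -- 0, the second 13 (8 + 9 − 1) = 208 ≥ 130 cos² θ.
    refine nonneg_of_transport_system (a := fun t θ => a θ + |K| * tan θ ^ 2 * exp (-(1 * t)))
      (b := fun t θ => b θ + 13 * |K| * tan θ ^ 2 * exp (-(1 * t)))
      (α₁ := 6) (α₂ := 9) (B := B) (β₁ := fun _ => 1) (β₂ := fun θ => 130 * cos θ ^ 2) (Λ := 130)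
      (fun _ => ⟨by norm_num, by norm_num⟩)
      (fun θ => ⟨by positivity, by nlinarith [cos_sq_le_one θ]⟩) ?_ ?_ ?_ ?_ ?_ ?_ ?_ ?_
    · exact (hca.comp continuousOn_snd fun p hp => hp.2).add (hcE T |K|)
    · exact (hcb.comp continuousOn_snd fun p hp => hp.2).add (hcE T (13 * |K|))
    · intro t _ θ hθ
      have : 0 ≤ |K| * tan θ ^ 2 * exp (-(1 * t)) := by positivity
      linarith [hBa θ hθ]
    · intro t _ θ hθ
      have : 0 ≤ 13 * |K| * tan θ ^ 2 * exp (-(1 * t)) := by positivity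
      linarith [hBb θ hθ]
    · intro θ hθ
      simp only [mul_zero, neg_zero, exp_zero, mul_one]
      linarith [hKa' θ hθ]
    · intro θ hθ
      have : 0 ≤ |K| * tan θ ^ 2 := by positivity
      simp only [mul_zero, neg_zero, exp_zero, mul_one]
      linarith [hKb' θ hθ]
    · intro t _ θ hθ
      refine ⟨_, _, ((hE t).const_mul (|K| * tan θ ^ 2)).const_add (a θ),
        (hda θ hθ).add (((hasDerivAt_tan_sq hθ).const_mul |K|).mul_const _), ?_⟩
      have h1 := two_sin_mul_deriv_tan_sq hθ
      have h2 := ha θ hθ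
      set y := 2 * tan θ / cos θ ^ 2
      set e := exp (-(1 * t))
      have h3 : 2 * sin (2 * θ) * (a' θ + |K| * y * e) =
        2 * sin (2 * θ) * a' θ + |K| * e * (8 * tan θ ^ 2) := by rw [← h1]; ring
      rw [h3]; linarith
    · intro t _ θ hθ
      refine ⟨_, _, ((hE t).const_mul (13 * |K| * tan θ ^ 2)).const_add (b θ),
        (hdb θ hθ).add (((hasDerivAt_tan_sq hθ).const_mul (13 * |K|)).mul_const _), ?_⟩
      have h1 := two_sin_mul_deriv_tan_sq hθ
      have h2 := hb θ hθ
      have hpos : 0 ≤ |K| * tan θ ^ 2 * exp (-(1 * t)) := by positivity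
      set y := 2 * tan θ / cos θ ^ 2
      set e := exp (-(1 * t))
      have h3 : 2 * sin (2 * θ) * (b' θ + 13 * |K| * y * e) =
        2 * sin (2 * θ) * b' θ + 13 * |K| * e * (8 * tan θ ^ 2) := by rw [← h1]; ring
      rw [h3]
      have h4 := mul_nonneg hpos (by linarith [cos_sq_le_one θ] : 0 ≤ 1 - cos θ ^ 2)
      linarith
  intro θ hθ
  constructor
  · refine ge_of_tendsto (tendsto_add_mul_exp_neg (a θ) (|K| * tan θ ^ 2) 1 (by norm_num)) ?_
    filter_upwards [Filter.eventually_ge_atTop 0] with t ht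
    exact (key t t ⟨ht, le_rfl⟩ θ hθ).1
  · refine ge_of_tendsto (tendsto_add_mul_exp_neg (b θ) (13 * |K| * tan θ ^ 2) 1 (by norm_num)) ?_
    filter_upwards [Filter.eventually_ge_atTop 0] with t ht
    exact (key t t ⟨ht, le_rfl⟩ θ hθ).2

/-! ### Cubics in sin² θ and angular averages -/

/-- The cubic polynomial `a + b w + c w² + d w³`. -/
def cubic (a b c d w : ℝ) : ℝ := a + b * w + c * w ^ 2 + d * w ^ 3

theorem hasDerivAt_cubic_sin_sq (a b c d θ : ℝ) :
    HasDerivAt (fun x => cubic a b c d (sin x ^ 2))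
      ((b + 2 * c * sin θ ^ 2 + 3 * d * (sin θ ^ 2) ^ 2) * sin (2 * θ)) θ := by
  have h1 : HasDerivAt (fun x => sin x ^ 2) (sin (2 * θ)) θ := by
    refine ((hasDerivAt_sin θ).pow 2).congr_deriv ?_
    rw [sin_two_mul]; simp
  have h2 := (((h1.const_mul b).const_add a).add ((h1.pow 2).const_mul c)).add
    ((h1.pow 3).const_mul d)
  refine h2.congr_deriv ?_
  push_cast; ring

theorem continuous_cubic_sin_sq (a b c d : ℝ) : Continuous fun x => cubic a b c d (sin x ^ 2) := by
  unfold cubic; fun_prop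

/-- In the variable w = sin² θ the operator 2 D_θ becomes 8 w (1 − w) d/dw, so all barrier
inequalities reduce to polynomial ones on [0, 1]. -/
theorem two_sin_mul_deriv_cubic (q θ : ℝ) :
    2 * sin (2 * θ) * (q * sin (2 * θ)) = 8 * sin θ ^ 2 * (1 - sin θ ^ 2) * q := by
  rw [sin_two_mul]
  have := cos_sq' θ
  linear_combination (8 * q * sin θ ^ 2) * this

theorem integral_sin_pow_add_two (n : ℕ) :
    ∫ x in (0 : ℝ)..(π / 2), sin x ^ (n + 2) =
      (n + 1) / (n + 2) * ∫ x in (0 : ℝ)..(π / 2), sin x ^ n := by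
  rw [integral_sin_pow]; simp

theorem angAvg_cubic_sin_sq (a b c d : ℝ) :
    angAvg (fun θ => cubic a b c d (sin θ ^ 2)) = a + b / 2 + 3 * c / 8 + 5 * d / 16 := by
  have h2 : ∫ x in (0 : ℝ)..(π / 2), sin x ^ 2 = π / 4 := by
    rw [integral_sin_sq]; simp; ring
  have h4 : ∫ x in (0 : ℝ)..(π / 2), sin x ^ 4 = 3 * π / 16 := by
    have := integral_sin_pow_add_two 2
    rw [h2] at this
    norm_num at this
    rw [this]; ring
  have h6 : ∫ x in (0 : ℝ)..(π / 2), sin x ^ 6 = 5 * π / 32 := by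
    have := integral_sin_pow_add_two 4
    rw [h4] at this
    norm_num at this
    rw [this]; ring
  have hi : ∀ (k : ℝ) (n : ℕ), IntervalIntegrable (fun x => k * sin x ^ n) MeasureTheory.volume
      0 (π / 2) := fun k n => (by fun_prop : Continuous fun x => k * sin x ^ n).intervalIntegrable _ _
  have : ∀ x, cubic a b c d (sin x ^ 2) =
      a * sin x ^ 0 + b * sin x ^ 2 + c * sin x ^ 4 + d * sin x ^ 6 := fun x => by
    unfold cubic; ring
  unfold angAvg
  simp_rw [this]
  rw [intervalIntegral.integral_add (((hi a 0).add (hi b 2)).add (hi c 4)) (hi d 6),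
    intervalIntegral.integral_add ((hi a 0).add (hi b 2)) (hi c 4),
    intervalIntegral.integral_add (hi a 0) (hi b 2)]
  simp only [intervalIntegral.integral_const_mul, h2, h4, h6]
  simp
  field_simp
  ring

theorem angAvg_mono {f g : ℝ → ℝ} (hf : ContinuousOn f (Icc 0 (π / 2)))
    (hg : ContinuousOn g (Icc 0 (π / 2))) (h : ∀ θ ∈ Ioo 0 (π / 2), f θ ≤ g θ) :
    angAvg f ≤ angAvg g := by
  have hpi : (0 : ℝ) ≤ π / 2 := by positivity
  refine mul_le_mul_of_nonneg_left ?_ (by positivity)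
  refine intervalIntegral.integral_mono_on_of_le_Ioo hpi ?_ ?_ h
  · exact (hf.mono (by rw [uIcc_of_le hpi])).intervalIntegrable
  · exact (hg.mono (by rw [uIcc_of_le hpi])).intervalIntegrable

theorem angAvg_congr {f g : ℝ → ℝ} (h : ∀ θ ∈ Ioo 0 (π / 2), f θ = g θ) :
    angAvg f = angAvg g := by
  unfold angAvg
  congr 1
  exact intervalIntegral.integral_congr_Ioo_of_le (by positivity) h

theorem intervalIntegrable_angle {f : ℝ → ℝ} (hf : ContinuousOn f (Icc 0 (π / 2))) :
    IntervalIntegrable f MeasureTheory.volume 0 (π / 2) :=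
  (hf.mono (by rw [uIcc_of_le (by positivity)])).intervalIntegrable

theorem angAvg_add {f g : ℝ → ℝ} (hf : ContinuousOn f (Icc 0 (π / 2)))
    (hg : ContinuousOn g (Icc 0 (π / 2))) :
    angAvg (fun θ => f θ + g θ) = angAvg f + angAvg g := by
  unfold angAvg
  rw [intervalIntegral.integral_add (intervalIntegrable_angle hf) (intervalIntegrable_angle hg),
    mul_add]

theorem angAvg_sub {f g : ℝ → ℝ} (hf : ContinuousOn f (Icc 0 (π / 2)))
    (hg : ContinuousOn g (Icc 0 (π / 2))) :
    angAvg (fun θ => f θ - g θ) = angAvg f - angAvg g := by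
  unfold angAvg
  rw [intervalIntegral.integral_sub (intervalIntegrable_angle hf) (intervalIntegrable_angle hg),
    mul_sub]

theorem angAvg_const_mul (k : ℝ) (f : ℝ → ℝ) :
    angAvg (fun θ => k * f θ) = k * angAvg f := by
  unfold angAvg
  rw [intervalIntegral.integral_const_mul]; ring

/-! ### The profile equations and their first integral -/

namespace IsAngularProfile

variable {G : ℝ → ℝ × ℝ}

theorem differentiableAt (hG : IsAngularProfile G) {θ : ℝ} (h : θ ∈ Ioo 0 (π / 2)) :
    DifferentiableAt ℝ G θ :=
  (hG.contDiffOn.differentiableOn one_ne_zero).differentiableAt (isOpen_Ioo.mem_nhds h)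

theorem hasDerivAt_fst (hG : IsAngularProfile G) {θ : ℝ} (h : θ ∈ Ioo 0 (π / 2)) :
    HasDerivAt (fun x => (G x).1) (deriv (fun x => (G x).1) θ) θ :=
  (hG.differentiableAt h).fst.hasDerivAt

theorem hasDerivAt_snd (hG : IsAngularProfile G) {θ : ℝ} (h : θ ∈ Ioo 0 (π / 2)) :
    HasDerivAt (fun x => (G x).2) (deriv (fun x => (G x).2) θ) θ :=
  (hG.differentiableAt h).snd.hasDerivAt

theorem eqn_fst (hG : IsAngularProfile G) {θ : ℝ} (h : θ ∈ Ioo 0 (π / 2)) :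
    2 * sin (2 * θ) * deriv (fun x => (G x).1) θ = -(6 * (G θ).1) + (G θ).2 := by
  have := congrArg Prod.fst (hG.eqn θ h)
  simp only [opLθ, angD, Prod.fst_zero] at this
  linarith

theorem eqn_snd (hG : IsAngularProfile G) {θ : ℝ} (h : θ ∈ Ioo 0 (π / 2)) :
    2 * sin (2 * θ) * deriv (fun x => (G x).2) θ =
      -(9 * (G θ).2) + 130 * cos θ ^ 2 * ((G θ).1 - 2) := by
  have := congrArg Prod.snd (hG.eqn θ h)
  simp only [opLθ, angD, Prod.snd_zero, hG.avg_eq] at this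
  linarith

theorem continuousOn_fst (hG : IsAngularProfile G) :
    ContinuousOn (fun x => (G x).1) (Icc 0 (π / 2)) := hG.continuousOn.fst

theorem continuousOn_snd (hG : IsAngularProfile G) :
    ContinuousOn (fun x => (G x).2) (Icc 0 (π / 2)) := hG.continuousOn.snd

theorem exists_bound (hG : IsAngularProfile G) : ∃ B, 0 ≤ B ∧
    ∀ θ ∈ Icc 0 (π / 2), |(G θ).1| ≤ B ∧ |(G θ).2| ≤ B := by
  obtain ⟨B, hB⟩ := isCompact_Icc.exists_bound_of_continuousOn hG.continuousOn
  refine ⟨|B|, abs_nonneg _, fun θ hθ => ⟨?_, ?_⟩⟩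
  · exact (norm_fst_le (G θ)).trans ((hB θ hθ).trans (le_abs_self B))
  · exact (norm_snd_le (G θ)).trans ((hB θ hθ).trans (le_abs_self B))

theorem integral_fst_sub (hG : IsAngularProfile G) :
    ∫ x in (0 : ℝ)..(π / 2), ((G x).1 - 2) = 0 := by
  have h := hG.avg_eq
  unfold angAvg at h
  rw [intervalIntegral.integral_sub (intervalIntegrable_angle hG.continuousOn_fst) (by simp)]
  have hpi := pi_pos
  field_simp at h
  simp
  linarith

/-- The first integral that excludes the singular mode `tan θ` at `θ = 0`. -/
theorem first_integral (hG : IsAngularProfile G) {θ : ℝ} (h : θ ∈ Ioo 0 (π / 2)) :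
    (13 * (G θ).1 + (G θ).2 - 65) * (cos θ / sin θ) =
      -(65 / 2) * ∫ x in (0 : ℝ)..θ, ((G x).1 - 2) := by
  set J : ℝ → ℝ := fun y => (13 * (G y).1 + (G y).2 - 65) * (cos y / sin y) +
      65 / 2 * ∫ x in (0 : ℝ)..y, ((G x).1 - 2) with hJ
  have hcont2 : ContinuousOn (fun x => (G x).1 - 2) (Icc 0 (π / 2)) :=
    hG.continuousOn_fst.sub continuousOn_const
  have hsub : Icc θ (π / 2) ⊆ Icc 0 (π / 2) := Icc_subset_Icc_left h.1.le
  have hsin : ∀ y ∈ Icc θ (π / 2), 0 < sin y := fun y hy =>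
    sin_pos_of_pos_of_lt_pi (h.1.trans_le hy.1) (by linarith [hy.2, pi_pos])
  have hJc : ContinuousOn J (Icc θ (π / 2)) := by
    refine ContinuousOn.add (ContinuousOn.mul ?_ ?_) (continuousOn_const.mul ?_)
    · exact (((hG.continuousOn_fst.mono hsub).const_mul 13).add
        (hG.continuousOn_snd.mono hsub)).sub continuousOn_const
    · exact continuousOn_cos.div continuousOn_sin fun y hy => (hsin y hy).ne'
    · exact (continuousOn_primitive_Icc (by positivity) hcont2).mono hsub
  have hJd : ∀ y ∈ Ioo θ (π / 2), HasDerivAt J 0 y := by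
    intro y hy
    have hy' : y ∈ Ioo 0 (π / 2) := ⟨h.1.trans hy.1, hy.2⟩
    have hs := hsin y ⟨hy.1.le, hy.2.le⟩
    have hc : 0 < cos y := cos_pos_of_mem_Ioo ⟨by linarith [hy'.1, pi_pos], hy'.2⟩
    have h1 := (((hG.hasDerivAt_fst hy').const_mul 13).add (hG.hasDerivAt_snd hy')).sub_const 65
    have h2 := (hasDerivAt_cos y).div (hasDerivAt_sin y) hs.ne'
    have h3 := (hasDerivAt_primitive hcont2 hy').const_mul (65 / 2)
    refine ((h1.mul h2).add h3).congr_deriv ?_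
    have e1 := hG.eqn_fst hy'
    have e2 := hG.eqn_snd hy'
    rw [sin_two_mul] at e1 e2
    set p := deriv (fun x => (G x).1) y
    set q := deriv (fun x => (G x).2) y
    have hcs := sin_sq_add_cos_sq y
    simp only [Pi.add_apply, Pi.div_apply]
    field_simp
    -- (13, 1) is the left eigenvector for the eigenvalue −4 at θ = 0, and cot is the matching
    -- integrating factor.
    have : 4 * ((13 * p + q) * (sin y * cos y)) =
      13 * (-(6 * (G y).1) + (G y).2) + -(9 * (G y).2) + 130 * cos y ^ 2 * ((G y).1 - 2) := by
      linear_combination 13 * e1 + e2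
    linear_combination (1 / 2) * this + (-26 * (G y).1 - 2 * (G y).2 + 130) * hcs +
      65 * ((G y).1 - 2) * hcs
  -- J is constant on [θ, π/2]. Its value at π/2 is zero because cos vanishes there and G₁ − 2 has
  -- zero mean.
  obtain ⟨y, hy, hslope⟩ := exists_hasDerivAt_eq_slope J (fun _ => 0) h.2 hJc hJd
  have hJeq : J (π / 2) = J θ := by
    have : (π / 2 - θ) ≠ 0 := by linarith [h.2]
    rw [eq_div_iff this] at hslope
    linarith
  have hJ0 : J (π / 2) = 0 := by
    simp [hJ, hG.integral_fst_sub]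
  have : J θ = 0 := hJeq.symm.trans hJ0
  simp only [hJ] at this
  linarith

end IsAngularProfile

/-! ### Polynomial inequalities on [0, 1] -/

/-- Positivity certificate in the Bernstein basis of degree 5. The term (1 − w)⁵ is absent because
the residuals to which it is applied vanish at w = 0. -/
theorem nonneg_of_bernstein {w β₁ β₂ β₃ β₄ β₅ : ℝ} (h0 : 0 ≤ w) (h1 : w ≤ 1) (hβ₁ : 0 ≤ β₁)
    (hβ₂ : 0 ≤ β₂) (hβ₃ : 0 ≤ β₃) (hβ₄ : 0 ≤ β₄) (hβ₅ : 0 ≤ β₅) :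
    0 ≤ β₁ * w * (1 - w) ^ 4 + β₂ * w ^ 2 * (1 - w) ^ 3 + β₃ * w ^ 3 * (1 - w) ^ 2 +
      β₄ * w ^ 4 * (1 - w) + β₅ * w ^ 5 := by
  obtain ⟨c, hc, rfl⟩ : ∃ c, 0 ≤ c ∧ w = 1 - c := ⟨1 - w, by linarith, by ring⟩
  rw [sub_sub_cancel]
  have := sub_nonneg.2 h1
  positivity

/-- The derivative of `cubic a b c d`. -/
def dcubic (b c d w : ℝ) : ℝ := b + 2 * c * w + 3 * d * w ^ 2

theorem deriv_cubic_sin_sq (a b c d θ : ℝ) :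
    HasDerivAt (fun x => cubic a b c d (sin x ^ 2))
      (dcubic b c d (sin θ ^ 2) * sin (2 * θ)) θ :=
  hasDerivAt_cubic_sin_sq a b c d θ

/-! Explicit polynomials in `w = sin² θ`: an approximation `(profFst, profSnd)` of the profile with
error bounds `(errFst, errSnd)`, a corrector `(corrFst, corrSnd)`, a barrier `(barFst, barSnd)` and a
supersolution `(fastFst, fastSnd)` for the fastest decaying mode. -/

noncomputable abbrev profFst (w : ℝ) : ℝ := cubic (65 / 19) (-17 / 10) (-13 / 10) (-2 / 5) w
noncomputable abbrev profSnd (w : ℝ) : ℝ := cubic (390 / 19) (-24) (-16) 18 w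
noncomputable abbrev errFst (w : ℝ) : ℝ := cubic 0 (3 / 20) (1 / 2) 0 w
noncomputable abbrev errSnd (w : ℝ) : ℝ := cubic 0 (17 / 10) 10 (-10) w
noncomputable abbrev corrFst (w : ℝ) : ℝ := cubic 0 (-34) 34 0 w
noncomputable abbrev corrSnd (w : ℝ) : ℝ := cubic 0 580 (-480) 0 w
noncomputable abbrev barFst (w : ℝ) : ℝ := cubic 0 (2 / 5) 1 (1 / 5) w
noncomputable abbrev barSnd (w : ℝ) : ℝ := cubic 0 4 18 (-17) w
noncomputable abbrev fastFst (w : ℝ) : ℝ := cubic 1 (-2) 1 0 w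
noncomputable abbrev fastSnd (w : ℝ) : ℝ := cubic (-13) 10 19 (-16) w

section Polynomials

set_option linter.unusedSimpArgs false

variable {w : ℝ}

/-- The local part of L_θ applied to the error bounds dominates the defect of the approximate
profile, so error ± (profile − approximation) are both supersolutions. This is the first row;
`prof_residual_snd` is the second. -/
theorem prof_residual_fst (h0 : 0 ≤ w) (h1 : w ≤ 1) :
    |8 * w * (1 - w) * dcubic (-17 / 10) (-13 / 10) (-2 / 5) w + 6 * profFst w - profSnd w| ≤
      8 * w * (1 - w) * dcubic (3 / 20) (1 / 2) 0 w + 6 * errFst w - errSnd w := by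
  have hc : 0 ≤ 1 - w := by linarith
  have e₁ : 0 ≤ w * (3 / 5 + 4 / 5 * w - 36 / 5 * w ^ 2 + 48 / 5 * w ^ 3) := by
    refine mul_nonneg h0 ?_
    -- The squares are centred near the interior minimum of the cubic, here and in the similar hints
    -- below.
    nlinarith [mul_nonneg h0 (sq_nonneg (w - 44 / 100)),
      mul_nonneg hc (sq_nonneg (w - 44 / 100)), mul_nonneg h0 hc, mul_nonneg h0 (sq_nonneg (w - 1))]
  have e₂ : 0 ≤ w * (1 / 5 - 6 / 5 * w + 56 / 5 * w ^ 2 - 48 / 5 * w ^ 3) := by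
    refine mul_nonneg h0 ?_
    nlinarith [mul_nonneg h0 (sq_nonneg (w - 6 / 100)),
      mul_nonneg hc (sq_nonneg (w - 6 / 100)), mul_nonneg h0 hc, mul_nonneg h0 (sq_nonneg (w - 1))]
  simp only [profFst, profSnd, errFst, errSnd, corrFst, corrSnd, barFst, barSnd, fastFst,
    fastSnd, cubic, dcubic]
  exact abs_le.2 ⟨by linarith, by linarith⟩

theorem prof_residual_snd (h0 : 0 ≤ w) (h1 : w ≤ 1) :
    |8 * w * (1 - w) * dcubic (-24) (-16) 18 w + 9 * profSnd w -
        130 * (1 - w) * (profFst w - 2)| ≤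
      8 * w * (1 - w) * dcubic (17 / 10) 10 (-10) w + 9 * errSnd w -
        130 * (1 - w) * errFst w := by
  have hc : 0 ≤ 1 - w := by linarith
  have e₁ : 0 ≤ w * (678 / 95 - 691 / 10 * w + 308 * w ^ 2 - 244 * w ^ 3) := by
    refine mul_nonneg h0 ?_
    nlinarith [mul_nonneg h0 (sq_nonneg (w - 15 / 100)),
      mul_nonneg hc (sq_nonneg (w - 15 / 100)), mul_nonneg h0 hc, mul_nonneg h0 (sq_nonneg (w - 1))]
  have e₂ : 0 ≤ w * (1108 / 95 + 4509 / 10 * w - 1158 * w ^ 2 + 724 * w ^ 3) := by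
    refine mul_nonneg h0 ?_
    nlinarith [mul_nonneg h0 (sq_nonneg (w - 81 / 100)),
      mul_nonneg hc (sq_nonneg (w - 81 / 100)), mul_nonneg h0 hc, mul_nonneg h0 (sq_nonneg (w - 1))]
  simp only [profFst, profSnd, errFst, errSnd, corrFst, corrSnd, barFst, barSnd, fastFst,
    fastSnd, cubic, dcubic]
  exact abs_le.2 ⟨by linarith, by linarith⟩

/-- The coefficients are 5 − 18 = −13 and, in the second row, 8 − 18 = −10: a supersolution for
decay rate 18, equal to the eigenvector (1, −13) at w = 0. -/
theorem fast_residual_fst :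
    8 * w * (1 - w) * dcubic (-2) 1 0 w - 13 * fastFst w - fastSnd w = 0 := by
  simp only [profFst, profSnd, errFst, errSnd, corrFst, corrSnd, barFst, barSnd, fastFst,
    fastSnd, cubic, dcubic]
  ring

theorem fast_residual_snd (h0 : 0 ≤ w) (h1 : w ≤ 1) :
    0 ≤ 8 * w * (1 - w) * dcubic 10 19 (-16) w - 10 * fastSnd w -
      130 * (1 - w) * fastFst w := by
  have e := nonneg_of_bernstein (β₁ := 370) (β₂ := 1124)
    (β₃ := 754) (β₄ := 0) (β₅ := 0) h0 h1
    (by norm_num) (by norm_num) (by norm_num) (by norm_num) (by norm_num)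
  simp only [profFst, profSnd, errFst, errSnd, corrFst, corrSnd, barFst, barSnd, fastFst,
    fastSnd, cubic, dcubic]
  linarith

/-- The right side is what the barrier gains per unit M; the left side is the worst remainder of the
two relaxing terms. The factors 1/9 = 2/18 and 1/234 = 2/468 come from the bounds on z and z'. The
z-term leaves 65 cos² θ − 19 G₁, zero at θ = 0; the corrector nearly cancels it, and 19 `errFst`
pays for replacing G₁ by its approximation. The corrector relaxes at rate 26, whence −21 = 5 − 26
(and −18 = 8 − 26 in the second row). -/
theorem bar_residual_fst (h0 : 0 ≤ w) (h1 : w ≤ 1) :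
    1 / 9 * (|65 * (1 - w) - 19 * profFst w - corrFst w| + 19 * errFst w) + 1 / 234 *
      |8 * w * (1 - w) * dcubic (-34) 34 0 w - 21 * corrFst w - corrSnd w| ≤
      8 * w * (1 - w) * dcubic (2 / 5) 1 (1 / 5) w + 5 * barFst w - barSnd w := by
  have hc : 0 ≤ 1 - w := by linarith
  have e1 := nonneg_of_bernstein (β₁ := 3109 / 2340) (β₂ := 508 / 195)
    (β₃ := 1901 / 234) (β₄ := 5234 / 585) (β₅ := 4913 / 2340) h0 h1
    (by norm_num) (by norm_num) (by norm_num) (by norm_num) (by norm_num)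
  have e2 := nonneg_of_bernstein (β₁ := 349 / 2340) (β₂ := 186 / 65)
    (β₃ := 883 / 78) (β₄ := 5764 / 585) (β₅ := 971 / 780) h0 h1
    (by norm_num) (by norm_num) (by norm_num) (by norm_num) (by norm_num)
  have e3 := nonneg_of_bernstein (β₁ := 757 / 468) (β₂ := 991 / 585)
    (β₃ := 139 / 26) (β₄ := 4259 / 585) (β₅ := 941 / 468) h0 h1
    (by norm_num) (by norm_num) (by norm_num) (by norm_num) (by norm_num)
  have e4 := nonneg_of_bernstein (β₁ := 205 / 468) (β₂ := 1141 / 585)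
    (β₃ := 1999 / 234) (β₄ := 4789 / 585) (β₅ := 541 / 468) h0 h1
    (by norm_num) (by norm_num) (by norm_num) (by norm_num) (by norm_num)
  rcases abs_cases (65 * (1 - w) - 19 * profFst w - corrFst w) with ⟨h, -⟩ | ⟨h, -⟩ <;>
  rcases abs_cases (8 * w * (1 - w) * dcubic (-34) 34 0 w - 21 * corrFst w - corrSnd w) with ⟨h', -⟩ | ⟨h', -⟩ <;>
  rw [h, h'] <;>
  simp only [profFst, profSnd, errFst, errSnd, corrFst, corrSnd, barFst, barSnd, fastFst,
    fastSnd, cubic, dcubic] <;> linarith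

theorem bar_residual_snd (h0 : 0 ≤ w) (h1 : w ≤ 1) :
    1 / 9 * (|390 * (1 - w) + 520 * (1 - w) * w - 19 * profSnd w - corrSnd w| + 19 * errSnd w) + 1 / 234 *
      |8 * w * (1 - w) * dcubic 580 (-480) 0 w - 18 * corrSnd w - 130 * (1 - w) * corrFst w| ≤
      8 * w * (1 - w) * dcubic 4 18 (-17) w + 8 * barSnd w - 130 * (1 - w) * barFst w := by
  have hc : 0 ≤ 1 - w := by linarith
  have e1 := nonneg_of_bernstein (β₁ := 15961 / 1170) (β₂ := 222082 / 585)
    (β₃ := 196813 / 585) (β₄ := 13192 / 585) (β₅ := 60961 / 1170) h0 h1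
    (by norm_num) (by norm_num) (by norm_num) (by norm_num) (by norm_num)
  have e2 : 0 ≤ w * (2161 / 1170 + 8504 / 39 * w - 24070 / 39 * w ^ 2 + 434 * w ^ 3) := by
    refine mul_nonneg h0 ?_
    nlinarith [mul_nonneg h0 (sq_nonneg (w - 71 / 100)),
      mul_nonneg hc (sq_nonneg (w - 71 / 100)), mul_nonneg h0 hc, mul_nonneg h0 (sq_nonneg (w - 1))]
  have e3 := nonneg_of_bernstein (β₁ := 17521 / 1170) (β₂ := 259522 / 585)
    (β₃ := 259993 / 585) (β₄ := 30352 / 585) (β₅ := 42241 / 1170) h0 h1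
    (by norm_num) (by norm_num) (by norm_num) (by norm_num) (by norm_num)
  have e4 : 0 ≤ w * (3721 / 1170 + 10792 / 39 * w - 27034 / 39 * w ^ 2 + 434 * w ^ 3) := by
    refine mul_nonneg h0 ?_
    nlinarith [mul_nonneg h0 (sq_nonneg (w - 80 / 100)),
      mul_nonneg hc (sq_nonneg (w - 80 / 100)), mul_nonneg h0 hc, mul_nonneg h0 (sq_nonneg (w - 1))]
  rcases abs_cases (390 * (1 - w) + 520 * (1 - w) * w - 19 * profSnd w - corrSnd w) with ⟨h, -⟩ | ⟨h, -⟩ <;>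
  rcases abs_cases (8 * w * (1 - w) * dcubic 580 (-480) 0 w - 18 * corrSnd w - 130 * (1 - w) * corrFst w) with ⟨h', -⟩ | ⟨h', -⟩ <;>
  rw [h, h'] <;>
  simp only [profFst, profSnd, errFst, errSnd, corrFst, corrSnd, barFst, barSnd, fastFst,
    fastSnd, cubic, dcubic] <;> linarith

/-- The variant with the source present. It enters with weight 1/2 since only M ≥ 2 is known, after
65/19 times the fast mode has removed its value at w = 0. -/
theorem bar_residual_fst_forced (h0 : 0 ≤ w) (h1 : w ≤ 1) :
    1 / 9 * (|65 * (1 - w) - 19 * profFst w - corrFst w| + 19 * errFst w) + 1 / 234 *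
      |8 * w * (1 - w) * dcubic (-34) 34 0 w - 21 * corrFst w - corrSnd w| ≤
      8 * w * (1 - w) * dcubic (2 / 5) 1 (1 / 5) w + 5 * barFst w - barSnd w +
      1 / 2 * (2 * profFst w - profSnd w / 2 + 65 / 19 * fastFst w - 2 * errFst w - errSnd w / 2) := by
  have hc : 0 ≤ 1 - w := by linarith
  have e1 := nonneg_of_bernstein (β₁ := 145169 / 88920) (β₂ := 7753 / 1482)
    (β₃ := 523703 / 44460) (β₄ := 213283 / 22230) (β₅ := 125737 / 88920) h0 h1
    (by norm_num) (by norm_num) (by norm_num) (by norm_num) (by norm_num)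
  have e2 := nonneg_of_bernstein (β₁ := 40289 / 88920) (β₂ := 2711 / 494)
    (β₃ := 221941 / 14820) (β₄ := 233423 / 22230) (β₅ := 16579 / 29640) h0 h1
    (by norm_num) (by norm_num) (by norm_num) (by norm_num) (by norm_num)
  have e3 := nonneg_of_bernstein (β₁ := 170857 / 88920) (β₂ := 96041 / 22230)
    (β₃ := 44467 / 4940) (β₄ := 176233 / 22230) (β₅ := 117833 / 88920) h0 h1
    (by norm_num) (by norm_num) (by norm_num) (by norm_num) (by norm_num)
  have e4 := nonneg_of_bernstein (β₁ := 65977 / 88920) (β₂ := 101741 / 22230)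
    (β₃ := 542323 / 44460) (β₄ := 196373 / 22230) (β₅ := 41833 / 88920) h0 h1
    (by norm_num) (by norm_num) (by norm_num) (by norm_num) (by norm_num)
  rcases abs_cases (65 * (1 - w) - 19 * profFst w - corrFst w) with ⟨h, -⟩ | ⟨h, -⟩ <;>
  rcases abs_cases (8 * w * (1 - w) * dcubic (-34) 34 0 w - 21 * corrFst w - corrSnd w) with ⟨h', -⟩ | ⟨h', -⟩ <;>
  rw [h, h'] <;>
  simp only [profFst, profSnd, errFst, errSnd, corrFst, corrSnd, barFst, barSnd, fastFst,
    fastSnd, cubic, dcubic] <;> linarith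

theorem bar_residual_snd_forced (h0 : 0 ≤ w) (h1 : w ≤ 1) :
    1 / 9 * (|390 * (1 - w) + 520 * (1 - w) * w - 19 * profSnd w - corrSnd w| + 19 * errSnd w) + 1 / 234 *
      |8 * w * (1 - w) * dcubic 580 (-480) 0 w - 18 * corrSnd w - 130 * (1 - w) * corrFst w| ≤
      8 * w * (1 - w) * dcubic 4 18 (-17) w + 8 * barSnd w - 130 * (1 - w) * barFst w +
      1 / 2 * (2 * profSnd w + (1 - w) * (520 * w - 455) * profFst w + 1560 * (1 - w) -
        1040 * (1 - w) * w + 65 / 19 * fastSnd w - 2 * errSnd w - |(1 - w) * (520 * w - 455)| * errFst w) := by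
  have hc : 0 ≤ 1 - w := by linarith
  have e1 := nonneg_of_bernstein (β₁ := 70574497 / 88920) (β₂ := 12376037 / 4680)
    (β₃ := 190802627 / 88920) (β₄ := 21335573 / 88920) (β₅ := 543854 / 11115) h0 h1
    (by norm_num) (by norm_num) (by norm_num) (by norm_num) (by norm_num)
  have e2 := nonneg_of_bernstein (β₁ := 64505707 / 88920) (β₂ := 10718147 / 4680)
    (β₃ := 169128377 / 88920) (β₄ := 25092443 / 88920) (β₅ := 543854 / 11115) h0 h1
    (by norm_num) (by norm_num) (by norm_num) (by norm_num) (by norm_num)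
  have e3 := nonneg_of_bernstein (β₁ := 69525697 / 88920) (β₂ := 11654437 / 4680)
    (β₃ := 55053409 / 29640) (β₄ := 6986773 / 88920) (β₅ := 372854 / 11115) h0 h1
    (by norm_num) (by norm_num) (by norm_num) (by norm_num) (by norm_num)
  have e4 := nonneg_of_bernstein (β₁ := 63456907 / 88920) (β₂ := 9996547 / 4680)
    (β₃ := 47828659 / 29640) (β₄ := 10743643 / 88920) (β₅ := 372854 / 11115) h0 h1
    (by norm_num) (by norm_num) (by norm_num) (by norm_num) (by norm_num)
  have e5 := nonneg_of_bernstein (β₁ := 70693057 / 88920) (β₂ := 12675557 / 4680)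
    (β₃ := 200405987 / 88920) (β₄ := 23943893 / 88920) (β₅ := 366014 / 11115) h0 h1
    (by norm_num) (by norm_num) (by norm_num) (by norm_num) (by norm_num)
  have e6 := nonneg_of_bernstein (β₁ := 64624267 / 88920) (β₂ := 11017667 / 4680)
    (β₃ := 178731737 / 88920) (β₄ := 27700763 / 88920) (β₅ := 366014 / 11115) h0 h1
    (by norm_num) (by norm_num) (by norm_num) (by norm_num) (by norm_num)
  have e7 := nonneg_of_bernstein (β₁ := 69644257 / 88920) (β₂ := 11953957 / 4680)
    (β₃ := 58254529 / 29640) (β₄ := 9595093 / 88920) (β₅ := 195014 / 11115) h0 h1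
    (by norm_num) (by norm_num) (by norm_num) (by norm_num) (by norm_num)
  have e8 := nonneg_of_bernstein (β₁ := 63575467 / 88920) (β₂ := 10296067 / 4680)
    (β₃ := 51029779 / 29640) (β₄ := 13351963 / 88920) (β₅ := 195014 / 11115) h0 h1
    (by norm_num) (by norm_num) (by norm_num) (by norm_num) (by norm_num)
  rcases abs_cases (390 * (1 - w) + 520 * (1 - w) * w - 19 * profSnd w - corrSnd w) with ⟨h, -⟩ | ⟨h, -⟩ <;>
  rcases abs_cases (8 * w * (1 - w) * dcubic 580 (-480) 0 w - 18 * corrSnd w - 130 * (1 - w) * corrFst w) with ⟨h', -⟩ | ⟨h', -⟩ <;>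
  rcases abs_cases ((1 - w) * (520 * w - 455)) with ⟨h'', -⟩ | ⟨h'', -⟩ <;>
  rw [h, h', h''] <;>
  simp only [profFst, profSnd, errFst, errSnd, corrFst, corrSnd, barFst, barSnd, fastFst,
    fastSnd, cubic, dcubic] <;> linarith

end Polynomials

/-! ### Enclosure of the profile -/

theorem sin_sq_le_tan_sq {θ : ℝ} (h : θ ∈ Ioo 0 (π / 2)) : sin θ ^ 2 ≤ tan θ ^ 2 := by
  have hc : 0 < cos θ := cos_pos_of_mem_Ioo ⟨by linarith [h.1, pi_pos], h.2⟩
  rw [tan_eq_sin_div_cos, div_pow, le_div_iff₀ (by positivity)]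
  nlinarith [cos_sq_le_one θ, sq_nonneg (sin θ)]

namespace IsAngularProfile

variable {G : ℝ → ℝ × ℝ}

/-- By the first integral this combination is tan θ times an integral over [0, θ] of a bounded
function, and θ ≤ tan θ. -/
theorem exists_abs_combination_le (hG : IsAngularProfile G) : ∃ K, 0 ≤ K ∧
    ∀ θ ∈ Ioo 0 (π / 2), |13 * (G θ).1 + (G θ).2 - 65| ≤ K * tan θ ^ 2 := by
  obtain ⟨B, hB0, hB⟩ := hG.exists_bound
  refine ⟨65 / 2 * (B + 2), by positivity, fun θ hθ => ?_⟩
  have hc : 0 < cos θ := cos_pos_of_mem_Ioo ⟨by linarith [hθ.1, pi_pos], hθ.2⟩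
  have hs : 0 < sin θ := sin_pos_of_pos_of_lt_pi hθ.1 (by linarith [hθ.2, pi_pos])
  have ht : 0 < tan θ := by rw [tan_eq_sin_div_cos]; positivity
  have h1 : ‖∫ x in (0 : ℝ)..θ, ((G x).1 - 2)‖ ≤ (B + 2) * |θ - 0| := by
    refine intervalIntegral.norm_integral_le_of_norm_le_const fun x hx => ?_
    rw [uIoc_of_le hθ.1.le] at hx
    have := (hB x ⟨hx.1.le, hx.2.trans hθ.2.le⟩).1
    rw [norm_eq_abs]
    exact (abs_sub _ _).trans (by simpa using this)
  rw [sub_zero, abs_of_pos hθ.1, norm_eq_abs] at h1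
  have h2 := hG.first_integral hθ
  have h3 : 13 * (G θ).1 + (G θ).2 - 65 =
      -(65 / 2) * (∫ x in (0 : ℝ)..θ, ((G x).1 - 2)) * tan θ := by
    rw [← h2, tan_eq_sin_div_cos]
    field_simp
  rw [h3, abs_mul, abs_mul, abs_of_pos ht]
  have h4 : θ ≤ tan θ := le_tan hθ.1.le hθ.2
  have h5 : |(-(65 / 2) : ℝ)| = 65 / 2 := by norm_num
  rw [h5]
  have h6 : |∫ x in (0 : ℝ)..θ, ((G x).1 - 2)| ≤ (B + 2) * tan θ :=
    h1.trans (mul_le_mul_of_nonneg_left h4 (by positivity))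
  nlinarith

/-- The first profile equation reads (2 D_θ + 19)(G₁ − 65/19) = 13 G₁ + G₂ − 65, whose right side is
O(tan² θ). Scalar comparison with ± K tan² θ gives the bound. -/
theorem exists_abs_fst_sub_le (hG : IsAngularProfile G) : ∃ K, 0 ≤ K ∧
    ∀ θ ∈ Ioo 0 (π / 2), |(G θ).1 - 65 / 19| ≤ K * tan θ ^ 2 := by
  obtain ⟨B, hB0, hB⟩ := hG.exists_bound
  obtain ⟨K, hK0, hK⟩ := hG.exists_abs_combination_le
  have key : ∀ s : ℝ, |s| = 1 → ∀ θ ∈ Ioo 0 (π / 2),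
      0 ≤ K * tan θ ^ 2 + s * ((G θ).1 - 65 / 19) := by
    intro s hs
    refine nonneg_of_stationary_scalar (B := B + 65 / 19)
      (f' := fun θ => K * (2 * tan θ / cos θ ^ 2) + s * deriv (fun x => (G x).1) θ) ?_ ?_ ?_
    · intro θ hθ
      have h1 := (hB θ ⟨hθ.1.le, hθ.2.le⟩).1
      have h2 : |s * ((G θ).1 - 65 / 19)| ≤ B + 65 / 19 := by
        rw [abs_mul, hs, one_mul]
        refine (abs_sub _ _).trans ?_
        rw [abs_of_pos (by norm_num : (0 : ℝ) < 65 / 19)]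
        linarith
      have h3 : 0 ≤ K * tan θ ^ 2 := by positivity
      linarith [(abs_le.1 h2).1]
    · intro θ hθ
      exact ((hasDerivAt_tan_sq hθ).const_mul K).add (((hG.hasDerivAt_fst hθ).sub_const _).const_mul s)
    · intro θ hθ
      have h1 := two_sin_mul_deriv_tan_sq hθ
      have h2 := hG.eqn_fst hθ
      have h3 : |s * (13 * (G θ).1 + (G θ).2 - 65)| ≤ K * tan θ ^ 2 := by
        rw [abs_mul, hs, one_mul]; exact hK θ hθ
      have h4 := (abs_le.1 h3).1
      have h5 : 0 ≤ K * tan θ ^ 2 := by positivity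
      have h6 : 2 * sin (2 * θ) * (K * (2 * tan θ / cos θ ^ 2) + s * deriv (fun x => (G x).1) θ) +
          19 * (K * tan θ ^ 2 + s * ((G θ).1 - 65 / 19)) =
          27 * (K * tan θ ^ 2) + s * (13 * (G θ).1 + (G θ).2 - 65) := by
        linear_combination K * h1 + s * h2
      rw [h6]; linarith
  refine ⟨K, hK0, fun θ hθ => abs_le.2 ⟨?_, ?_⟩⟩
  · linarith [key 1 (by norm_num) θ hθ]
  · linarith [key (-1) (by norm_num) θ hθ]

/-- Stationary comparison applied to error ± (G − approximation). The tan² θ bounds hold because the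
approximation has the exact values 65/19 and 390/19 at θ = 0. -/
theorem enclosure (hG : IsAngularProfile G) {θ : ℝ} (hθ : θ ∈ Ioo 0 (π / 2)) :
    |(G θ).1 - profFst (sin θ ^ 2)| ≤ errFst (sin θ ^ 2) ∧
      |(G θ).2 - profSnd (sin θ ^ 2)| ≤ errSnd (sin θ ^ 2) := by
  obtain ⟨B, hB0, hB⟩ := hG.exists_bound
  obtain ⟨K₁, hK₁0, hK₁⟩ := hG.exists_abs_combination_le
  obtain ⟨K₂, hK₂0, hK₂⟩ := hG.exists_abs_fst_sub_le
  have key : ∀ s : ℝ, |s| = 1 → ∀ θ ∈ Ioo 0 (π / 2),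
      0 ≤ errFst (sin θ ^ 2) + s * ((G θ).1 - profFst (sin θ ^ 2)) ∧
      0 ≤ errSnd (sin θ ^ 2) + s * ((G θ).2 - profSnd (sin θ ^ 2)) := by
    intro s hs
    have hE : ∀ θ, 0 ≤ errFst (sin θ ^ 2) ∧ 0 ≤ errSnd (sin θ ^ 2) := by
      intro θ
      have h0 := sq_nonneg (sin θ)
      have h1 := sin_sq_le_one θ
      simp only [errFst, errSnd, cubic]
      generalize sin θ ^ 2 = w at h0 h1
      constructor
      · positivity
      · nlinarith [mul_nonneg (sq_nonneg w) (sub_nonneg.2 h1)]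
    -- 58 = 24 + 16 + 18 is the sum of the absolute values of the nonconstant coefficients of
    -- `profSnd`.
    have hP : ∀ θ ∈ Ioo 0 (π / 2), |profFst (sin θ ^ 2) - 65 / 19| ≤ 58 * sin θ ^ 2 ∧
        |profSnd (sin θ ^ 2) - 390 / 19| ≤ 58 * sin θ ^ 2 := by
      intro θ _
      have h0 := sq_nonneg (sin θ)
      have h1 := sin_sq_le_one θ
      simp only [profFst, profSnd, cubic]
      generalize sin θ ^ 2 = w at h0 h1
      have h2 := mul_nonneg h0 (sub_nonneg.2 h1)
      have h3 := mul_nonneg (mul_nonneg h0 h0) (sub_nonneg.2 h1)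
      have h4 : 0 ≤ w ^ 3 := by positivity
      have h5 : 0 ≤ w ^ 2 := by positivity
      refine ⟨abs_le.2 ⟨by nlinarith, by nlinarith⟩, abs_le.2 ⟨by nlinarith, by nlinarith⟩⟩
    have hd1 : ∀ θ ∈ Ioo 0 (π / 2), |s * ((G θ).1 - profFst (sin θ ^ 2))| ≤
        (K₂ + 58) * tan θ ^ 2 := by
      intro θ hθ
      rw [abs_mul, hs, one_mul]
      have h1 := hK₂ θ hθ
      have h2 := (hP θ hθ).1
      have h3 := sin_sq_le_tan_sq hθ
      rw [abs_le] at *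
      constructor <;> linarith [h1.1, h1.2, h2.1, h2.2]
    have hd2 : ∀ θ ∈ Ioo 0 (π / 2), |s * ((G θ).2 - profSnd (sin θ ^ 2))| ≤
        (K₁ + 13 * K₂ + 58) * tan θ ^ 2 := by
      intro θ hθ
      rw [abs_mul, hs, one_mul]
      have h0 := hK₁ θ hθ
      have h1 := hK₂ θ hθ
      have h2 := (hP θ hθ).2
      have h3 := sin_sq_le_tan_sq hθ
      rw [abs_le] at *
      constructor <;> linarith [h1.1, h1.2, h2.1, h2.2, h0.1, h0.2]
    have hlow : ∀ θ ∈ Ioo 0 (π / 2),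
        -(B + 100) ≤ s * ((G θ).1 - profFst (sin θ ^ 2)) ∧
        -(B + 100) ≤ s * ((G θ).2 - profSnd (sin θ ^ 2)) := by
      intro θ hθ
      have h1 := hB θ ⟨hθ.1.le, hθ.2.le⟩
      have h2 := hP θ hθ
      have h3 := sin_sq_le_one θ
      simp only [abs_le] at h1 h2
      constructor
      · refine (abs_le.1 (?_ : |s * ((G θ).1 - profFst (sin θ ^ 2))| ≤ _)).1
        rw [abs_mul, hs, one_mul, abs_le]
        constructor <;> linarith [h1.1.1, h1.1.2, h2.1.1, h2.1.2]
      · refine (abs_le.1 (?_ : |s * ((G θ).2 - profSnd (sin θ ^ 2))| ≤ _)).1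
        rw [abs_mul, hs, one_mul, abs_le]
        constructor <;> linarith [h1.2.1, h1.2.2, h2.2.1, h2.2.2]
    refine nonneg_of_stationary_system (B := B + 100) (K := K₁ + 13 * K₂ + 58)
      (a' := fun θ => dcubic (3 / 20) (1 / 2) 0 (sin θ ^ 2) * sin (2 * θ) +
        s * (deriv (fun x => (G x).1) θ -
          dcubic (-17 / 10) (-13 / 10) (-2 / 5) (sin θ ^ 2) * sin (2 * θ)))
      (b' := fun θ => dcubic (17 / 10) 10 (-10) (sin θ ^ 2) * sin (2 * θ) +
        s * (deriv (fun x => (G x).2) θ -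
          dcubic (-24) (-16) 18 (sin θ ^ 2) * sin (2 * θ)))
      ?_ ?_ ?_ ?_ ?_ ?_ ?_ ?_
    · intro θ hθ
      linarith [(hE θ).1, (hlow θ hθ).1]
    · intro θ hθ
      linarith [(hE θ).2, (hlow θ hθ).2]
    · intro θ hθ
      have := (abs_le.1 (hd1 θ hθ)).1
      have h2 : 0 ≤ (K₁ + 12 * K₂) * tan θ ^ 2 := by positivity
      linarith [(hE θ).1]
    · intro θ hθ
      have := (abs_le.1 (hd2 θ hθ)).1
      linarith [(hE θ).2]
    · intro θ hθ
      exact (deriv_cubic_sin_sq _ _ _ _ θ).add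
        (((hG.hasDerivAt_fst hθ).sub (deriv_cubic_sin_sq _ _ _ _ θ)).const_mul s)
    · intro θ hθ
      exact (deriv_cubic_sin_sq _ _ _ _ θ).add
        (((hG.hasDerivAt_snd hθ).sub (deriv_cubic_sin_sq _ _ _ _ θ)).const_mul s)
    · intro θ hθ
      have hr := prof_residual_fst (sq_nonneg (sin θ)) (sin_sq_le_one θ)
      have e1 := two_sin_mul_deriv_cubic (dcubic (3 / 20) (1 / 2) 0 (sin θ ^ 2)) θ
      have e2 := two_sin_mul_deriv_cubic
        (dcubic (-17 / 10) (-13 / 10) (-2 / 5) (sin θ ^ 2)) θ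
      have e3 := hG.eqn_fst hθ
      generalize sin θ ^ 2 = w at *
      set R := 8 * w * (1 - w) * dcubic (-17 / 10) (-13 / 10) (-2 / 5) w + 6 * profFst w -
        profSnd w with hR
      have h1 : |s * R| ≤ _ := (by rw [abs_mul, hs, one_mul] : |s * R| = |R|).trans_le hr
      have h2 := (abs_le.1 h1).2
      refine (sub_nonneg.2 h2).trans_eq ?_
      linear_combination (-1) * e1 + s * e2 - s * e3 + s * hR
    · intro θ hθ
      have hr := prof_residual_snd (sq_nonneg (sin θ)) (sin_sq_le_one θ)
      have e1 := two_sin_mul_deriv_cubic (dcubic (17 / 10) 10 (-10) (sin θ ^ 2)) θ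
      have e2 := two_sin_mul_deriv_cubic (dcubic (-24) (-16) 18 (sin θ ^ 2)) θ
      have e3 := hG.eqn_snd hθ
      have hc := cos_sq' θ
      rw [hc] at e3 ⊢
      generalize sin θ ^ 2 = w at *
      set R := 8 * w * (1 - w) * dcubic (-24) (-16) 18 w + 9 * profSnd w -
        130 * (1 - w) * (profFst w - 2) with hR
      have h1 : |s * R| ≤ _ := (by rw [abs_mul, hs, one_mul] : |s * R| = |R|).trans_le hr
      have h2 := (abs_le.1 h1).2
      refine (sub_nonneg.2 h2).trans_eq ?_
      linear_combination (-1) * e1 + s * e2 - s * e3 + s * hR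
  have h1 := key 1 (by norm_num) θ hθ
  have h2 := key (-1) (by norm_num) θ hθ
  exact ⟨abs_le.2 ⟨by linarith [h1.1], by linarith [h2.1]⟩,
    abs_le.2 ⟨by linarith [h1.2], by linarith [h2.2]⟩⟩

/-- The averaged quantity is the first component of `angF G`, rewritten by the profile equation;
this is the bound Y(0) ≥ 2. -/
theorem two_le_angAvg (hG : IsAngularProfile G) :
    2 ≤ angAvg (fun θ => ((G θ).2 - (G θ).1) / 2) := by
  have h1 : angAvg (fun θ => profSnd (sin θ ^ 2) - errSnd (sin θ ^ 2)) ≤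
      angAvg (fun θ => (G θ).2) := by
    refine angAvg_mono ?_ hG.continuousOn_snd fun θ hθ => ?_
    · exact ((continuous_cubic_sin_sq _ _ _ _).sub (continuous_cubic_sin_sq _ _ _ _)).continuousOn
    · linarith [(abs_le.1 (hG.enclosure hθ).2).1]
  rw [angAvg_sub (continuous_cubic_sin_sq _ _ _ _).continuousOn
    (continuous_cubic_sin_sq _ _ _ _).continuousOn, angAvg_cubic_sin_sq, angAvg_cubic_sin_sq] at h1
  have h2 : angAvg (fun θ => ((G θ).2 - (G θ).1) / 2) =
      1 / 2 * (angAvg (fun θ => (G θ).2) - angAvg (fun θ => (G θ).1)) := by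
    rw [← angAvg_sub hG.continuousOn_snd hG.continuousOn_fst, ← angAvg_const_mul]
    congr 1; ext θ; ring
  rw [h2, hG.avg_eq]
  linarith

end IsAngularProfile

/-! ### Relaxation amplitudes and propagation of the barrier -/

/-- Duhamel's formula solves z' = −a z + f, and [L/a, H/a] is invariant. The bounds do not depend on
T, which lets one barrier be propagated over consecutive intervals. -/
theorem exists_relaxation {a L H z₀ T : ℝ} (ha : 0 < a) {f : ℝ → ℝ} (hf : Continuous f)
    (hL : ∀ t ∈ Icc 0 T, L ≤ f t) (hH : ∀ t ∈ Icc 0 T, f t ≤ H)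
    (h0L : L / a ≤ z₀) (h0H : z₀ ≤ H / a) :
    ∃ z : ℝ → ℝ, z 0 = z₀ ∧ Continuous z ∧ (∀ t, HasDerivAt z (-a * z t + f t) t) ∧
      ∀ t ∈ Icc 0 T, L / a ≤ z t ∧ z t ≤ H / a := by
  have hE : ∀ k t : ℝ, HasDerivAt (fun s => exp (k * s)) (k * exp (k * t)) t := fun k t => by
    have := ((hasDerivAt_id t).const_mul k).exp
    simpa [mul_comm] using this
  have hcont : Continuous fun s => exp (a * s) * f s := by fun_prop
  set z : ℝ → ℝ := fun t => exp (-a * t) * (z₀ + ∫ s in (0 : ℝ)..t, exp (a * s) * f s) with hz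
  have hd : ∀ t, HasDerivAt z (-a * z t + f t) t := by
    intro t
    have h1 := (hcont.integral_hasStrictDerivAt 0 t).hasDerivAt.const_add z₀
    refine ((hE (-a) t).mul h1).congr_deriv ?_
    have h2 : exp (-a * t) * (exp (a * t) * f t) = f t := by
      rw [← mul_assoc, ← exp_add]; simp
    rw [h2, hz]; ring
  have hc : Continuous z := continuous_iff_continuousAt.2 fun t => (hd t).continuousAt
  have hz0 : z 0 = z₀ := by simp [hz]
  have mono : ∀ s k : ℝ, (∀ t ∈ Icc 0 T, 0 ≤ s * f t - k) → 0 ≤ s * z₀ - k / a →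
      ∀ t ∈ Icc 0 T, 0 ≤ s * z t - k / a := by
    intro s k h1 h2 t ht
    have hy : ∀ t, HasDerivAt (fun t => exp (a * t) * (s * z t - k / a))
        (exp (a * t) * (s * f t - k)) t := by
      intro t
      refine ((hE a t).mul (((hd t).const_mul s).sub_const (k / a))).congr_deriv ?_
      field_simp
      ring
    have hm : MonotoneOn (fun t => exp (a * t) * (s * z t - k / a)) (Icc 0 T) := by
      refine monotoneOn_of_deriv_nonneg (convex_Icc 0 T) (by fun_prop)
        (fun t _ => (hy t).differentiableAt.differentiableWithinAt) fun t ht => ?_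
      rw [(hy t).deriv]
      exact mul_nonneg (exp_pos _).le (h1 t (interior_subset ht))
    have h3 := hm ⟨le_rfl, ht.1.trans ht.2⟩ ht ht.1
    simp only [mul_zero, exp_zero, one_mul, hz0] at h3
    exact (mul_nonneg_iff_of_pos_left (exp_pos _)).1 (h2.trans h3)
  refine ⟨z, hz0, hc, hd, fun t ht => ⟨?_, ?_⟩⟩
  · have := mono 1 L (fun t ht => by linarith [hL t ht]) (by linarith) t ht
    linarith
  · have := mono (-1) (-H) (fun t ht => by linarith [hH t ht]) (by rw [neg_div]; linarith) t ht
    rw [neg_div] at this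
    linarith

theorem hasDerivAt_cos_sq (θ : ℝ) : HasDerivAt (fun x => cos x ^ 2) (-sin (2 * θ)) θ := by
  refine ((hasDerivAt_cos θ).pow 2).congr_deriv ?_
  rw [sin_two_mul]; simp; ring

theorem two_sin_mul_deriv_cos_sq (θ : ℝ) :
    2 * sin (2 * θ) * -sin (2 * θ) = -(8 * sin θ ^ 2 * cos θ ^ 2) := by
  rw [sin_two_mul]; ring

/-- The relaxing terms cost at most M times the left side A of `h`. For κ = 0 it remains that M (x −
A) ≥ 0; for κ = 1, that S + M (x − A) ≥ s + 2 (x − A) ≥ 0, which uses M ≥ 2. -/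
theorem forcing_nonneg {M κ z z' u k x s S δ E : ℝ} (hM : 2 ≤ M) (hκ : κ = 0 ∨ κ = 1)
    (hz : |z| ≤ M / 18) (hz' : |z'| ≤ M / 468) (hδ : |δ| ≤ E) (hS : s ≤ S)
    (h : 1 / 9 * (|u| + 19 * E) + 1 / 234 * |k| ≤ x)
    (h' : 1 / 9 * (|u| + 19 * E) + 1 / 234 * |k| ≤ x + 1 / 2 * s) :
    0 ≤ κ * S - 2 * z * (u - 19 * δ) + 2 * z' * k + M * x := by
  have hM0 : 0 ≤ M := by linarith
  have h1 : |u - 19 * δ| ≤ |u| + 19 * E := by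
    refine (abs_sub _ _).trans ?_
    rw [abs_mul, abs_of_pos (by norm_num : (0 : ℝ) < 19)]
    linarith
  have h2 : |z * (u - 19 * δ)| ≤ M / 18 * (|u| + 19 * E) := by
    rw [abs_mul]
    exact mul_le_mul hz h1 (abs_nonneg _) (by positivity)
  have h3 : |z' * k| ≤ M / 468 * |k| := by
    rw [abs_mul]
    exact mul_le_mul_of_nonneg_right hz' (abs_nonneg _)
  have h4 := (abs_le.1 h2).2
  have h5 := (abs_le.1 h3).1
  set A := 1 / 9 * (|u| + 19 * E) + 1 / 234 * |k| with hA
  have h6 : κ * S + M * (x - A) ≤ κ * S - 2 * z * (u - 19 * δ) + 2 * z' * k + M * x := by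
    have : M * A = 2 * (M / 18 * (|u| + 19 * E)) + 2 * (M / 468 * |k|) := by rw [hA]; ring
    linarith
  refine le_trans ?_ h6
  rcases hκ with rfl | rfl
  · have := mul_nonneg hM0 (sub_nonneg.2 h); linarith
  · have := mul_nonneg (sub_nonneg.2 hM) (sub_nonneg.2 h); linarith

/-- Lower barrier of size `M` for the forced evolution, with three relaxation amplitudes. -/
def IsTrapped (G : ℝ → ℝ × ℝ) (M : ℝ) (p q : ℝ → ℝ) : Prop :=
  ∃ z z' ζ : ℝ, |z| ≤ M / 18 ∧ |z'| ≤ M / 468 ∧ 0 ≤ ζ ∧ ζ ≤ 1 / 18 ∧ ∀ θ ∈ Ioo 0 (π / 2),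
    0 ≤ p θ - 2 * z * (G θ).1 + 2 * z' * corrFst (sin θ ^ 2) +
      ζ * (65 / 19) * fastFst (sin θ ^ 2) + M * barFst (sin θ ^ 2) ∧
    0 ≤ q θ - 2 * z * ((G θ).2 - 65 * cos θ ^ 2) + 2 * z' * corrSnd (sin θ ^ 2) +
      ζ * (65 / 19) * fastSnd (sin θ ^ 2) + M * barSnd (sin θ ^ 2)

/-- With amplitudes driven by η, z and κ, the differences between the solution and its barrier form
a supersolution pair of the cooperative system, so they stay nonnegative. The final amplitudes obey
the same bounds as the initial ones. -/
theorem IsTrapped.evolve {G : ℝ → ℝ × ℝ} (hG : IsAngularProfile G) {M T κ : ℝ} (hM : 2 ≤ M)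
    (hT : 0 ≤ T) (hκ : κ = 0 ∨ κ = 1) {η : ℝ → ℝ} (hη : Continuous η)
    (hηM : ∀ t ∈ Icc 0 T, |η t| ≤ M) {p q : ℝ → ℝ → ℝ}
    (hp : ContinuousOn (fun x : ℝ × ℝ => p x.1 x.2) (Icc 0 T ×ˢ Icc 0 (π / 2)))
    (hq : ContinuousOn (fun x : ℝ × ℝ => q x.1 x.2) (Icc 0 T ×ˢ Icc 0 (π / 2)))
    (hpp : ∀ t ∈ Ioc 0 T, ∀ θ ∈ Ioo 0 (π / 2), ∃ x y, HasDerivAt (fun s => p s θ) x t ∧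
      HasDerivAt (p t) y θ ∧ x + 2 * sin (2 * θ) * y + 5 * p t θ - q t θ =
        κ * (2 * (G θ).1 - (G θ).2 / 2) + 2 * η t * (G θ).1)
    (hpq : ∀ t ∈ Ioc 0 T, ∀ θ ∈ Ioo 0 (π / 2), ∃ x y, HasDerivAt (fun s => q s θ) x t ∧
      HasDerivAt (q t) y θ ∧ x + 2 * sin (2 * θ) * y + 8 * q t θ - 130 * cos θ ^ 2 * p t θ =
        κ * (2 * (G θ).2 + 1560 * cos θ ^ 2 - 455 * cos θ ^ 2 * (G θ).1 +
          520 * cos θ ^ 2 * sin θ ^ 2 * ((G θ).1 - 2)) +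
        2 * η t * ((G θ).2 - 65 * cos θ ^ 2))
    (h0 : IsTrapped G M (p 0) (q 0)) : IsTrapped G M (p T) (q T) := by
  obtain ⟨z₀, z₀', ζ₀, hz₀, hz₀', hζ₀, hζ₀', h0⟩ := h0
  -- 18 is the positive eigenvalue at θ = 0, whose eigenvector is parallel to (G₁, G₂ − 65) there.
  obtain ⟨z, hz0, hzc, hzd, hzb⟩ := exists_relaxation (a := 18) (L := -M) (H := M) (z₀ := z₀)
    (T := T) (by norm_num) hη (fun t ht => (abs_le.1 (hηM t ht)).1)
    (fun t ht => (abs_le.1 (hηM t ht)).2) (by rw [neg_div]; exact (abs_le.1 hz₀).1)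
    (abs_le.1 hz₀).2
  -- The corrector is of first order in w, where 2 D_θ adds 8 to the rate 18. It is driven by z,
  -- hence the bound M / (18 · 26) = M / 468.
  obtain ⟨z', hz0', hzc', hzd', hzb'⟩ := exists_relaxation (a := 26) (L := -M / 18) (H := M / 18)
    (z₀ := z₀') (T := T) (by norm_num) hzc (fun t ht => (hzb t ht).1)
    (fun t ht => (hzb t ht).2) (by linarith [(abs_le.1 hz₀').1])
    (by linarith [(abs_le.1 hz₀').2])
  have hκ0 : 0 ≤ κ := by rcases hκ with h | h <;> rw [h]; norm_num
  have hκ1 : κ ≤ 1 := by rcases hκ with h | h <;> rw [h]; norm_num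
  obtain ⟨ζ, hζ0, hζc, hζd, hζb⟩ := exists_relaxation (a := 18) (L := 0) (H := 1)
    (z₀ := ζ₀) (T := T) (f := fun _ => κ) (by norm_num) continuous_const (fun _ _ => hκ0)
    (fun _ _ => hκ1) (by simpa using hζ₀) hζ₀'
  have hza : ∀ t ∈ Icc 0 T, |z t| ≤ M / 18 := fun t ht => abs_le.2
    ⟨by have := (hzb t ht).1; rw [neg_div] at this; exact this, (hzb t ht).2⟩
  have hza' : ∀ t ∈ Icc 0 T, |z' t| ≤ M / 468 := fun t ht => abs_le.2
    ⟨by have := (hzb' t ht).1; linarith, by have := (hzb' t ht).2; linarith⟩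
  have hTT : T ∈ Icc 0 T := ⟨hT, le_rfl⟩
  refine ⟨z T, z' T, ζ T, hza T hTT, hza' T hTT, by simpa using (hζb T hTT).1, (hζb T hTT).2, ?_⟩
  set a : ℝ → ℝ → ℝ := fun t θ => p t θ - 2 * z t * (G θ).1 + 2 * z' t * corrFst (sin θ ^ 2) +
      ζ t * (65 / 19) * fastFst (sin θ ^ 2) + M * barFst (sin θ ^ 2) with ha
  set b : ℝ → ℝ → ℝ := fun t θ => q t θ - 2 * z t * ((G θ).2 - 65 * cos θ ^ 2) +
      2 * z' t * corrSnd (sin θ ^ 2) + ζ t * (65 / 19) * fastSnd (sin θ ^ 2) +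
      M * barSnd (sin θ ^ 2) with hb
  have hcubic : ∀ k₀ k₁ k₂ k₃, ContinuousOn (fun x : ℝ × ℝ => cubic k₀ k₁ k₂ k₃ (sin x.2 ^ 2))
      (Icc 0 T ×ˢ Icc 0 (π / 2)) := fun _ _ _ _ =>
    ((continuous_cubic_sin_sq _ _ _ _).comp continuous_snd).continuousOn
  have hG1 : ContinuousOn (fun x : ℝ × ℝ => (G x.2).1) (Icc 0 T ×ˢ Icc 0 (π / 2)) :=
    hG.continuousOn_fst.comp continuousOn_snd fun x hx => hx.2
  have hG2 : ContinuousOn (fun x : ℝ × ℝ => (G x.2).2) (Icc 0 T ×ˢ Icc 0 (π / 2)) :=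
    hG.continuousOn_snd.comp continuousOn_snd fun x hx => hx.2
  have hac : ContinuousOn (fun x : ℝ × ℝ => a x.1 x.2) (Icc 0 T ×ˢ Icc 0 (π / 2)) :=
    (((hp.sub (ContinuousOn.mul (by fun_prop) hG1)).add
      (ContinuousOn.mul (by fun_prop) (hcubic _ _ _ _))).add
      (ContinuousOn.mul (by fun_prop) (hcubic _ _ _ _))).add
      (continuousOn_const.mul (hcubic _ _ _ _))
  have hbc : ContinuousOn (fun x : ℝ × ℝ => b x.1 x.2) (Icc 0 T ×ˢ Icc 0 (π / 2)) :=
    (((hq.sub (ContinuousOn.mul (by fun_prop) (hG2.sub (by fun_prop)))).add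
      (ContinuousOn.mul (by fun_prop) (hcubic _ _ _ _))).add
      (ContinuousOn.mul (by fun_prop) (hcubic _ _ _ _))).add
      (continuousOn_const.mul (hcubic _ _ _ _))
  have hcomp : IsCompact (Icc 0 T ×ˢ Icc 0 (π / 2)) := isCompact_Icc.prod isCompact_Icc
  obtain ⟨A, hA⟩ := hcomp.exists_bound_of_continuousOn hac
  obtain ⟨B, hB⟩ := hcomp.exists_bound_of_continuousOn hbc
  have hsub : Icc 0 T ×ˢ Ioo 0 (π / 2) ⊆ Icc 0 T ×ˢ Icc 0 (π / 2) :=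
    prod_mono_right Ioo_subset_Icc_self
  refine nonneg_of_transport_system (a := a) (b := b) (α₁ := 5) (α₂ := 8) (B := max A B)
    (β₁ := fun _ => 1) (β₂ := fun θ => 130 * cos θ ^ 2) (Λ := 130)
    (fun _ => ⟨by norm_num, by norm_num⟩)
    (fun θ => ⟨by positivity, by nlinarith [cos_sq_le_one θ]⟩)
    (hac.mono hsub) (hbc.mono hsub) ?_ ?_ ?_ ?_ ?_ ?_ T hTT
  · intro t ht θ hθ
    have h1 : |a t θ| ≤ A := hA (t, θ) (hsub ⟨ht, hθ⟩)
    linarith [(abs_le.1 h1).1, le_max_left A B]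
  · intro t ht θ hθ
    have h1 : |b t θ| ≤ B := hB (t, θ) (hsub ⟨ht, hθ⟩)
    linarith [(abs_le.1 h1).1, le_max_right A B]
  · intro θ hθ
    simp only [ha, hz0, hz0', hζ0]
    exact (h0 θ hθ).1
  · intro θ hθ
    simp only [hb, hz0, hz0', hζ0]
    exact (h0 θ hθ).2
  · intro t ht θ hθ
    have ht' : t ∈ Icc 0 T := ⟨ht.1.le, ht.2⟩
    obtain ⟨x, y, hx, hy, hxy⟩ := hpp t ht θ hθ
    refine ⟨_, _, (((hx.sub (((hzd t).const_mul 2).mul_const _)).add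
      (((hzd' t).const_mul 2).mul_const _)).add (((hζd t).mul_const _).mul_const _)).add_const _,
      (((hy.sub ((hG.hasDerivAt_fst hθ).const_mul _)).add
      ((deriv_cubic_sin_sq _ _ _ _ θ).const_mul _)).add
      ((deriv_cubic_sin_sq _ _ _ _ θ).const_mul _)).add
      ((deriv_cubic_sin_sq _ _ _ _ θ).const_mul M), ?_⟩
    have e0 := hG.eqn_fst hθ
    have e1 := two_sin_mul_deriv_cubic (dcubic (-34) 34 0 (sin θ ^ 2)) θ
    have e2 := two_sin_mul_deriv_cubic (dcubic (-2) 1 0 (sin θ ^ 2)) θ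
    have e3 := two_sin_mul_deriv_cubic (dcubic (2 / 5) 1 (1 / 5) (sin θ ^ 2)) θ
    have hw0 := sq_nonneg (sin θ)
    have hw1 := sin_sq_le_one θ
    have hen := hG.enclosure hθ
    have hc := cos_sq' θ
    simp only [ha, hb, hc]
    generalize sin θ ^ 2 = w at *
    have hf := fast_residual_fst (w := w)
    have hS : 2 * profFst w - profSnd w / 2 + 65 / 19 * fastFst w - 2 * errFst w - errSnd w / 2 ≤
        2 * (G θ).1 - (G θ).2 / 2 + 65 / 19 * fastFst w := by
      linarith [(abs_le.1 hen.1).1, (abs_le.1 hen.2).2]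
    refine (forcing_nonneg hM hκ (hza t ht') (hza' t ht') hen.1 hS (bar_residual_fst hw0 hw1)
      (bar_residual_fst_forced hw0 hw1)).trans_eq ?_
    linear_combination (-1) * hxy + 2 * z t * e0 - 2 * z' t * e1 -
      ζ t * (65 / 19) * e2 - M * e3 - ζ t * (65 / 19) * hf
  · intro t ht θ hθ
    have ht' : t ∈ Icc 0 T := ⟨ht.1.le, ht.2⟩
    obtain ⟨x, y, hx, hy, hxy⟩ := hpq t ht θ hθ
    refine ⟨_, _, (((hx.sub (((hzd t).const_mul 2).mul_const _)).add
      (((hzd' t).const_mul 2).mul_const _)).add (((hζd t).mul_const _).mul_const _)).add_const _,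
      (((hy.sub (((hG.hasDerivAt_snd hθ).sub ((hasDerivAt_cos_sq θ).const_mul 65)).const_mul _)).add
      ((deriv_cubic_sin_sq _ _ _ _ θ).const_mul _)).add
      ((deriv_cubic_sin_sq _ _ _ _ θ).const_mul _)).add
      ((deriv_cubic_sin_sq _ _ _ _ θ).const_mul M), ?_⟩
    have e0 := hG.eqn_snd hθ
    have e1 := two_sin_mul_deriv_cubic (dcubic 580 (-480) 0 (sin θ ^ 2)) θ
    have e2 := two_sin_mul_deriv_cubic (dcubic 10 19 (-16) (sin θ ^ 2)) θ
    have e3 := two_sin_mul_deriv_cubic (dcubic 4 18 (-17) (sin θ ^ 2)) θ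
    have e4 := two_sin_mul_deriv_cos_sq θ
    have hw0 := sq_nonneg (sin θ)
    have hw1 := sin_sq_le_one θ
    have hen := hG.enclosure hθ
    have hc := cos_sq' θ
    simp only [ha, hb, hc] at e0 e4 hxy ⊢
    generalize sin θ ^ 2 = w at *
    have hf := mul_nonneg (mul_nonneg (by simpa using (hζb t ht').1 : 0 ≤ ζ t)
      (by norm_num : (0 : ℝ) ≤ 65 / 19)) (fast_residual_snd hw0 hw1)
    have hS : 2 * profSnd w + (1 - w) * (520 * w - 455) * profFst w + 1560 * (1 - w) -
        1040 * (1 - w) * w + 65 / 19 * fastSnd w - 2 * errSnd w -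
        |(1 - w) * (520 * w - 455)| * errFst w ≤
        2 * (G θ).2 + 1560 * (1 - w) - 455 * (1 - w) * (G θ).1 +
          520 * (1 - w) * w * ((G θ).1 - 2) + 65 / 19 * fastSnd w := by
      have h1 : |(1 - w) * (520 * w - 455) * ((G θ).1 - profFst w)| ≤
          |(1 - w) * (520 * w - 455)| * errFst w := by
        rw [abs_mul]
        exact mul_le_mul_of_nonneg_left hen.1 (abs_nonneg _)
      linarith [(abs_le.1 h1).1, (abs_le.1 hen.2).1]
    refine (add_nonneg (forcing_nonneg hM hκ (hza t ht') (hza' t ht') hen.2 hS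
      (bar_residual_snd hw0 hw1) (bar_residual_snd_forced hw0 hw1)) hf).trans_eq ?_
    linear_combination (-1) * hxy + 2 * z t * e0 - 130 * z t * e4 - 2 * z' t * e1 -
      ζ t * (65 / 19) * e2 - M * e3

/-! ### Parametric integrals and derivatives of time integrals -/

theorem continuous_comp_clamp {E : Type*} [TopologicalSpace E] {f : ℝ × ℝ → E} {a b t₀ t₁ : ℝ}
    (ht : t₀ ≤ t₁) (hab : a ≤ b) (hf : ContinuousOn f (Icc t₀ t₁ ×ˢ Icc a b)) :
    Continuous fun x : ℝ × ℝ => f (max t₀ (min t₁ x.1), max a (min b x.2)) :=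
  hf.comp_continuous (by fun_prop) fun x =>
    ⟨⟨le_max_left _ _, max_le ht (min_le_left _ _)⟩, le_max_left _ _, max_le hab (min_le_left _ _)⟩

theorem clamp_eq {a b x : ℝ} (h : x ∈ Icc a b) : max a (min b x) = x := by
  rw [min_eq_right h.2, max_eq_right h.1]

theorem continuousOn_parametric_integral {f : ℝ × ℝ → ℝ} {a b t₀ t₁ : ℝ} (ht : t₀ ≤ t₁)
    (hab : a ≤ b) (hf : ContinuousOn f (Icc t₀ t₁ ×ˢ Icc a b)) :
    ContinuousOn (fun t => ∫ θ in a..b, f (t, θ)) (Icc t₀ t₁) := by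
  have h := intervalIntegral.continuous_parametric_intervalIntegral_of_continuous'
    (μ := MeasureTheory.volume)
    (f := fun t θ => f (max t₀ (min t₁ t), max a (min b θ)))
    (continuous_comp_clamp ht hab hf) a b
  refine h.continuousOn.congr fun t ht' => intervalIntegral.integral_congr fun θ hθ => ?_
  rw [uIcc_of_le hab] at hθ
  simp only [clamp_eq ht', clamp_eq hθ]

/-- If `∂_θ P = ∂_t D` then `∂_θ ∫₀ᵗ P = D t - D 0`, with continuity only down to time `0`. -/
theorem hasDerivAt_integral_of_closed {P D y : ℝ → ℝ → ℝ} {a b t : ℝ} (ht : 0 < t)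
    (hP : ContinuousOn (fun x : ℝ × ℝ => P x.1 x.2) (Icc 0 t ×ˢ Icc a b))
    (hD : ContinuousOn (fun x : ℝ × ℝ => D x.1 x.2) (Icc 0 t ×ˢ Icc a b))
    (hy : ContinuousOn (fun x : ℝ × ℝ => y x.1 x.2) (Ioc 0 t ×ˢ Icc a b))
    (hPy : ∀ s ∈ Ioc 0 t, ∀ θ ∈ Icc a b, HasDerivAt (P s) (y s θ) θ)
    (hDy : ∀ s ∈ Ioc 0 t, ∀ θ ∈ Icc a b, HasDerivAt (fun r => D r θ) (y s θ) s)
    {θ : ℝ} (hθ : θ ∈ Ioo a b) :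
    HasDerivAt (fun φ => ∫ s in (0 : ℝ)..t, P s φ) (D t θ - D 0 θ) θ := by
  have hslice : ∀ s ∈ Icc 0 t, ContinuousOn (D s) (Icc a b) := fun s hs =>
    hD.comp (f := fun φ => (s, φ)) (by fun_prop) fun φ hφ => ⟨hs, hφ⟩
  have hPslice : ∀ φ ∈ Icc a b, ContinuousOn (fun s => P s φ) (Icc 0 t) := fun φ hφ =>
    hP.comp (f := fun s => (s, φ)) (by fun_prop) fun s hs => ⟨hs, hφ⟩
  have h0t : (0 : ℝ) ∈ Icc 0 t := ⟨le_rfl, ht.le⟩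
  have htt : t ∈ Icc 0 t := ⟨ht.le, le_rfl⟩
  -- The common derivative y may be singular at time 0, so Fubini is used on [ε, t]; continuity of P
  -- and D then allows ε → 0.
  have key : ∀ φ ∈ Icc a b, ∀ ε ∈ Ioc 0 t,
      (∫ s in ε..t, (P s φ - P s a)) = ∫ x in a..φ, (D t x - D ε x) := by
    intro φ hφ ε hε
    have hsub : Icc ε t ×ˢ Icc a φ ⊆ Ioc 0 t ×ˢ Icc a b :=
      prod_mono (fun s hs => ⟨hε.1.trans_le hs.1, hs.2⟩) (Icc_subset_Icc_right hφ.2)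
    have h1 : ∀ s ∈ uIcc ε t, P s φ - P s a = ∫ x in a..φ, y s x := by
      intro s hs
      rw [uIcc_of_le hε.2] at hs
      rw [intervalIntegral.integral_eq_sub_of_hasDerivAt]
      · intro x hx
        rw [uIcc_of_le hφ.1] at hx
        exact hPy s ⟨hε.1.trans_le hs.1, hs.2⟩ x ⟨hx.1, hx.2.trans hφ.2⟩
      · refine ContinuousOn.intervalIntegrable ?_
        rw [uIcc_of_le hφ.1]
        exact hy.comp (f := fun x => (s, x)) (by fun_prop) fun x hx => hsub ⟨hs, hx⟩
    have h2 : ∀ x ∈ uIcc a φ, (∫ s in ε..t, y s x) = D t x - D ε x := by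
      intro x hx
      rw [uIcc_of_le hφ.1] at hx
      rw [intervalIntegral.integral_eq_sub_of_hasDerivAt]
      · intro s hs
        rw [uIcc_of_le hε.2] at hs
        exact hDy s ⟨hε.1.trans_le hs.1, hs.2⟩ x ⟨hx.1, hx.2.trans hφ.2⟩
      · refine ContinuousOn.intervalIntegrable ?_
        rw [uIcc_of_le hε.2]
        exact hy.comp (f := fun s => (s, x)) (by fun_prop) fun s hs => hsub ⟨hs, hx⟩
    rw [intervalIntegral.integral_congr h1, ← intervalIntegral.integral_congr h2]
    refine MeasureTheory.intervalIntegral_intervalIntegral_swap ?_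
    rw [uIoc_of_le hε.2, uIoc_of_le hφ.1]
    exact ((hy.mono hsub).integrableOn_compact (isCompact_Icc.prod isCompact_Icc)).mono_set
      (prod_mono Ioc_subset_Icc_self Ioc_subset_Icc_self)
  have key0 : ∀ φ ∈ Icc a b,
      (∫ s in (0 : ℝ)..t, (P s φ - P s a)) = ∫ x in a..φ, (D t x - D 0 x) := by
    intro φ hφ
    have ha : a ∈ Icc a b := ⟨le_rfl, hφ.1.trans hφ.2⟩
    have hl : ContinuousOn (fun ε => ∫ s in ε..t, (P s φ - P s a)) (Icc 0 t) := by
      have := intervalIntegral.continuousOn_primitive_interval_left (μ := MeasureTheory.volume)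
        (f := fun s => P s φ - P s a) (a := 0) (b := t)
        (by rw [uIcc_of_le ht.le]
            exact ((hPslice φ hφ).sub (hPslice a ha)).integrableOn_Icc)
      rwa [uIcc_of_le ht.le] at this
    have hr : ContinuousOn (fun ε => ∫ x in a..φ, (D t x - D ε x)) (Icc 0 t) := by
      refine continuousOn_parametric_integral (f := fun p => D t p.2 - D p.1 p.2) ht.le hφ.1 ?_
      refine ContinuousOn.sub ?_ (hD.mono (prod_mono_right (Icc_subset_Icc_right hφ.2)))
      exact (hslice t htt).comp continuousOn_snd fun p hp => ⟨hp.2.1, hp.2.2.trans hφ.2⟩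
    have hcl : Icc 0 t ⊆ closure (Ioc 0 t) := by rw [closure_Ioc ht.ne]
    have : EqOn (fun ε => ∫ s in ε..t, (P s φ - P s a)) (fun ε => ∫ x in a..φ, (D t x - D ε x))
        (Icc 0 t) := EqOn.of_subset_closure (key φ hφ) hl hr Ioc_subset_Icc_self hcl
    exact this h0t
  have ha : a ∈ Icc a b := ⟨le_rfl, (hθ.1.trans hθ.2).le⟩
  have hd := (hasDerivAt_primitive ((hslice t htt).sub (hslice 0 h0t)) hθ).const_add
    (∫ s in (0 : ℝ)..t, P s a)
  refine hd.congr_of_eventuallyEq ?_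
  filter_upwards [Icc_mem_nhds hθ.1 hθ.2] with φ hφ
  have hi : ∀ φ ∈ Icc a b, IntervalIntegrable (fun s => P s φ) MeasureTheory.volume 0 t :=
    fun φ hφ => ((hPslice φ hφ).mono (by rw [uIcc_of_le ht.le])).intervalIntegrable
  have := key0 φ hφ
  rw [intervalIntegral.integral_sub (hi φ hφ) (hi a ha)] at this
  linarith!

/-! ### Averaged lower bound and the contradiction at a first zero -/

theorem barFst_sin_sq_nonneg (θ : ℝ) : 0 ≤ barFst (sin θ ^ 2) := by
  unfold barFst cubic; positivity

theorem barSnd_sin_sq_nonneg (θ : ℝ) : 0 ≤ barSnd (sin θ ^ 2) := by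
  have h0 := sq_nonneg (sin θ)
  have h1 := sin_sq_le_one θ
  unfold barSnd cubic
  generalize sin θ ^ 2 = w at *
  nlinarith [mul_nonneg (sq_nonneg w) (sub_nonneg.2 h1)]

theorem IsTrapped.of_eq_zero {G : ℝ → ℝ × ℝ} {M : ℝ} (hM : 0 ≤ M) {p q : ℝ → ℝ}
    (hp : ∀ θ ∈ Ioo 0 (π / 2), p θ = 0) (hq : ∀ θ ∈ Ioo 0 (π / 2), q θ = 0) :
    IsTrapped G M p q := by
  refine ⟨0, 0, 0, by rw [abs_zero]; positivity, by rw [abs_zero]; positivity, le_rfl, by norm_num, fun θ hθ => ?_⟩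
  rw [hp θ hθ, hq θ hθ]
  have h1 := mul_nonneg hM (barFst_sin_sq_nonneg θ)
  have h2 := mul_nonneg hM (barSnd_sin_sq_nonneg θ)
  exact ⟨by simpa using h1, by simpa using h2⟩

/-- The averages of `corrFst`, `fastFst`, `barFst` are −17/4, 3/8, 51/80. The coefficient of M is
4/18 + (17/2)/468 + 51/80 < 22/25, and the ζ-term is at most (65/19)(3/8)/18 < 2/25. What matters is
that 22/25 is below 1. -/
theorem IsTrapped.angAvg_lower {G : ℝ → ℝ × ℝ} (hG : IsAngularProfile G) {M : ℝ}
    {p q : ℝ → ℝ} (hp : ContinuousOn p (Icc 0 (π / 2))) (h : IsTrapped G M p q) :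
    -(22 / 25 * M + 2 / 25) ≤ angAvg p := by
  obtain ⟨z, z', ζ, hz, hz', hζ0, hζ1, h⟩ := h
  have hc : ∀ a b c d, ContinuousOn (fun θ => cubic a b c d (sin θ ^ 2)) (Icc 0 (π / 2)) :=
    fun a b c d => (continuous_cubic_sin_sq a b c d).continuousOn
  have hG1 : ContinuousOn (fun θ => 2 * z * (G θ).1) (Icc 0 (π / 2)) :=
    hG.continuousOn_fst.const_smul (2 * z)
  have hm := angAvg_mono (hG1.fun_add (hc (-(ζ * (65 / 19))) (68 * z' + ζ * (130 / 19) - M * (2 / 5))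
      (-(68 * z') - ζ * (65 / 19) - M) (-(M / 5)))) hp (fun θ hθ => by
    have := (h θ hθ).1
    simp only [corrFst, fastFst, barFst, cubic] at this ⊢
    linarith)
  rw [angAvg_add hG1 (hc _ _ _ _), angAvg_const_mul, hG.avg_eq, angAvg_cubic_sin_sq] at hm
  have h1 := (abs_le.1 hz).1
  have h2 := abs_le.1 hz'
  linarith [h2.1, h2.2]

/-- Forcing of the first component produced by the initial datum. -/
noncomputable def srcFst (G : ℝ → ℝ × ℝ) (θ : ℝ) : ℝ := 2 * (G θ).1 - (G θ).2 / 2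

/-- Forcing of the second component produced by the initial datum. -/
noncomputable def srcSnd (G : ℝ → ℝ × ℝ) (θ : ℝ) : ℝ :=
  2 * (G θ).2 + 1560 * cos θ ^ 2 - 455 * cos θ ^ 2 * (G θ).1 +
    520 * cos θ ^ 2 * sin θ ^ 2 * ((G θ).1 - 2)

/-- A first zero T of Y is compared with a maximum point τ on [0, T]. Shifting time by T − τ turns
p(T) − p(τ) into the endpoint of a source-free evolution, so no upper bound on p(τ) is needed. -/
theorem pos_of_forced_evolution {G : ℝ → ℝ × ℝ} (hG : IsAngularProfile G) {Y : ℝ → ℝ}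
    (hY : Continuous Y) {p q : ℝ → ℝ → ℝ}
    (hp : ContinuousOn (fun x : ℝ × ℝ => p x.1 x.2) (Ici 0 ×ˢ Icc 0 (π / 2)))
    (hq : ContinuousOn (fun x : ℝ × ℝ => q x.1 x.2) (Ici 0 ×ˢ Icc 0 (π / 2)))
    (hpp : ∀ t > 0, ∀ θ ∈ Ioo 0 (π / 2), ∃ x y, HasDerivAt (fun s => p s θ) x t ∧
      HasDerivAt (p t) y θ ∧ x + 2 * sin (2 * θ) * y + 5 * p t θ - q t θ =
        srcFst G θ + 2 * Y t * (G θ).1)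
    (hpq : ∀ t > 0, ∀ θ ∈ Ioo 0 (π / 2), ∃ x y, HasDerivAt (fun s => q s θ) x t ∧
      HasDerivAt (q t) y θ ∧ x + 2 * sin (2 * θ) * y + 8 * q t θ - 130 * cos θ ^ 2 * p t θ =
        srcSnd G θ + 2 * Y t * ((G θ).2 - 65 * cos θ ^ 2))
    (hp0 : ∀ θ ∈ Ioo 0 (π / 2), p 0 θ = 0) (hq0 : ∀ θ ∈ Ioo 0 (π / 2), q 0 θ = 0)
    (havg : ∀ t, 0 ≤ t → angAvg (p t) = Y t - Y 0) (hY0 : 2 ≤ Y 0) :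
    ∀ t, 0 ≤ t → 0 < Y t := by
  intro t₁ ht₁
  by_contra hneg
  push Not at hneg
  obtain ⟨T, ⟨⟨hT0, hT1⟩, hTY⟩, hleast⟩ :=
    (isCompact_Icc.inter_right (isClosed_le hY continuous_const) :
      IsCompact (Icc 0 t₁ ∩ {t | Y t ≤ 0})).exists_isLeast ⟨t₁, ⟨ht₁, le_rfl⟩, hneg⟩
  have hTY : Y T ≤ 0 := hTY
  have hpos : ∀ t ∈ Icc 0 T, 0 ≤ Y t := by
    have h1 : ∀ t ∈ Ico 0 T, 0 ≤ Y t := fun t ht => by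
      by_contra h
      exact absurd (hleast ⟨⟨ht.1, ht.2.le.trans hT1⟩, (not_le.1 h).le⟩) (not_le.2 ht.2)
    have hT : (0 : ℝ) ≠ T := by rintro rfl; linarith
    intro t ht
    have hcl : Icc 0 T ⊆ closure (Ico 0 T) := by rw [closure_Ico hT]
    exact (closure_minimal h1 (isClosed_le continuous_const hY)) (hcl ht)
  obtain ⟨τ, ⟨hτ0, hτT⟩, hτ⟩ :=
    (isCompact_Icc (a := (0 : ℝ)) (b := T)).exists_isMaxOn ⟨0, le_rfl, hT0⟩ hY.continuousOn
  have hle : ∀ t ∈ Icc 0 T, Y t ≤ Y τ := fun t ht => hτ ht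
  have hM : 2 ≤ Y τ := hY0.trans (hle 0 ⟨le_rfl, hT0⟩)
  set σ := T - τ with hσ
  have hσ0 : 0 ≤ σ := sub_nonneg.2 hτT
  have hsub : ∀ t : ℝ, Icc 0 t ×ˢ Icc 0 (π / 2) ⊆ Ici 0 ×ˢ Icc 0 (π / 2) := fun t =>
    prod_mono_left Icc_subset_Ici_self
  have first : IsTrapped G (Y τ) (p σ) (q σ) := by
    refine IsTrapped.evolve hG hM hσ0 (Or.inr rfl) hY (fun t ht => ?_) (hp.mono (hsub σ))
      (hq.mono (hsub σ)) ?_ ?_ (IsTrapped.of_eq_zero (by linarith) hp0 hq0)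
    · have ht' : t ∈ Icc 0 T := ⟨ht.1, by linarith [ht.2]⟩
      rw [abs_of_nonneg (hpos t ht')]
      exact hle t ht'
    · intro t ht θ hθ
      obtain ⟨x, y, hx, hy, h⟩ := hpp t ht.1 θ hθ
      exact ⟨x, y, hx, hy, by rw [h, one_mul, srcFst]⟩
    · intro t ht θ hθ
      obtain ⟨x, y, hx, hy, h⟩ := hpq t ht.1 θ hθ
      exact ⟨x, y, hx, hy, by rw [h, one_mul, srcSnd]⟩
  have shift : ∀ {r : ℝ → ℝ → ℝ},
      ContinuousOn (fun x : ℝ × ℝ => r x.1 x.2) (Ici 0 ×ˢ Icc 0 (π / 2)) →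
      ContinuousOn (fun x : ℝ × ℝ => r (x.1 + σ) x.2 - r x.1 x.2) (Icc 0 τ ×ˢ Icc 0 (π / 2)) := by
    intro r hr
    refine ContinuousOn.sub ?_ (hr.mono (hsub τ))
    refine hr.comp (f := fun x : ℝ × ℝ => (x.1 + σ, x.2)) (by fun_prop) fun x hx => ?_
    exact ⟨add_nonneg hx.1.1 hσ0, hx.2⟩
  -- The source cancels in the difference (κ = 0), and the new forcing is bounded by M because both
  -- values of Y lie in [0, M]. The initial datum is the state reached in `first`.
  have second : IsTrapped G (Y τ) (fun θ => p (τ + σ) θ - p τ θ) (fun θ => q (τ + σ) θ - q τ θ) := by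
    refine IsTrapped.evolve (p := fun t θ => p (t + σ) θ - p t θ)
      (q := fun t θ => q (t + σ) θ - q t θ) (η := fun t => Y (t + σ) - Y t) hG hM hτ0 (Or.inl rfl)
      (by fun_prop) (fun t ht => ?_) (shift hp) (shift hq) ?_ ?_ ?_
    · have h1 : t ∈ Icc 0 T := ⟨ht.1, ht.2.trans hτT⟩
      have h2 : t + σ ∈ Icc 0 T := ⟨add_nonneg ht.1 hσ0, by linarith [ht.2]⟩
      rw [abs_le]
      constructor <;> linarith [hpos _ h1, hpos _ h2, hle _ h1, hle _ h2]
    · intro t ht θ hθ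
      obtain ⟨x, y, hx, hy, h⟩ := hpp t ht.1 θ hθ
      obtain ⟨x', y', hx', hy', h'⟩ := hpp (t + σ) (add_pos_of_pos_of_nonneg ht.1 hσ0) θ hθ
      exact ⟨x' - x, y' - y, (hx'.comp_add_const t σ).sub hx, hy'.sub hy, by
        linear_combination h' - h⟩
    · intro t ht θ hθ
      obtain ⟨x, y, hx, hy, h⟩ := hpq t ht.1 θ hθ
      obtain ⟨x', y', hx', hy', h'⟩ := hpq (t + σ) (add_pos_of_pos_of_nonneg ht.1 hσ0) θ hθ
      exact ⟨x' - x, y' - y, (hx'.comp_add_const t σ).sub hx, hy'.sub hy, by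
        linear_combination h' - h⟩
    · obtain ⟨z, z', ζ, h1, h2, h3, h4, h⟩ := first
      refine ⟨z, z', ζ, h1, h2, h3, h4, fun θ hθ => ?_⟩
      simp only [zero_add, hp0 θ hθ, hq0 θ hθ, sub_zero]
      exact h θ hθ
  have slice : ∀ t, 0 ≤ t → ContinuousOn (p t) (Icc 0 (π / 2)) := fun t ht =>
    hp.comp (f := fun θ => (t, θ)) (by fun_prop) fun θ hθ => ⟨ht, hθ⟩
  have hτσ : τ + σ = T := by simp [hσ]
  rw [hτσ] at second
  have h := second.angAvg_lower hG ((slice T hT0).fun_sub (slice τ hτ0))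
  rw [angAvg_sub (slice T hT0) (slice τ hτ0), havg T hT0, havg τ hτ0] at h
  linarith

/-! ### Reduction to the forced local system -/

/-- Time integral of a solution of the transport equation `∂_t P + 2 sin(2θ) ∂_θ P = R`. -/
theorem hasDerivAt_integral_of_transport {P R y : ℝ → ℝ → ℝ}
    (hP : Continuous fun x : ℝ × ℝ => P x.1 x.2) (hR : Continuous fun x : ℝ × ℝ => R x.1 x.2)
    (hy : ContinuousOn (fun x : ℝ × ℝ => y x.1 x.2) (Ioi 0 ×ˢ Ioo 0 (π / 2)))
    (hPy : ∀ t > 0, ∀ θ ∈ Ioo 0 (π / 2), HasDerivAt (P t) (y t θ) θ)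
    (hPt : ∀ t > 0, ∀ θ ∈ Ioo 0 (π / 2),
      HasDerivAt (fun s => P s θ) (R t θ - 2 * sin (2 * θ) * y t θ) t)
    {t θ : ℝ} (ht : 0 < t) (hθ : θ ∈ Ioo 0 (π / 2)) :
    HasDerivAt (fun φ => ∫ s in (0 : ℝ)..t, P s φ)
      (((∫ s in (0 : ℝ)..t, R s θ) - (P t θ - P 0 θ)) / (2 * sin (2 * θ))) θ := by
  have hsub : Icc (θ / 2) ((θ + π / 2) / 2) ⊆ Ioo 0 (π / 2) := fun x hx =>
    ⟨by linarith [hx.1, hθ.1], by linarith [hx.2, hθ.2]⟩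
  have hs : ∀ x ∈ Ioo 0 (π / 2), 2 * sin (2 * x) ≠ 0 := fun x hx =>
    (mul_pos two_pos (sin_two_mul_pos hx)).ne'
  have hI : Continuous fun x : ℝ × ℝ => ∫ s in (0 : ℝ)..x.1, R s x.2 := by
    have := intervalIntegral.continuous_parametric_primitive_of_continuous
      (μ := MeasureTheory.volume) (f := fun φ s => R s φ) (a₀ := 0)
      (hR.comp (continuous_snd.prodMk continuous_fst))
    exact this.comp (continuous_snd.prodMk continuous_fst)
  -- The equation is solved for ∂_θ P: it is the time derivative of (∫₀ᵗ R − P) / (2 sin 2θ), which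
  -- is continuous down to time 0.
  have key := hasDerivAt_integral_of_closed (P := P) (y := y)
    (D := fun t φ => ((∫ s in (0 : ℝ)..t, R s φ) - P t φ) / (2 * sin (2 * φ)))
    (a := θ / 2) (b := (θ + π / 2) / 2) ht hP.continuousOn ?_
    (hy.mono (prod_mono (fun s hs => hs.1) hsub)) (fun s hs φ hφ => hPy s hs.1 φ (hsub hφ)) ?_
    (θ := θ) ⟨by linarith [hθ.1], by linarith [hθ.2]⟩
  · refine key.congr_deriv ?_
    simp only [intervalIntegral.integral_same]
    ring
  · exact ContinuousOn.div (hI.sub hP).continuousOn (by fun_prop) fun x hx => hs _ (hsub hx.2)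
  · intro s hs' φ hφ
    have hRφ : Continuous fun s => R s φ := hR.comp (by fun_prop : Continuous fun s : ℝ => (s, φ))
    have h1 := (hRφ.integral_hasStrictDerivAt 0 s).hasDerivAt
    refine ((h1.sub (hPt s hs'.1 φ (hsub hφ))).div_const (2 * sin (2 * φ))).congr_deriv ?_
    rw [div_eq_iff (hs φ (hsub hφ))]
    ring

theorem continuous_angAvg {P : ℝ → ℝ → ℝ} (hP : Continuous fun x : ℝ × ℝ => P x.1 x.2) :
    Continuous fun t => angAvg (P t) :=
  continuous_const.mul (intervalIntegral.continuous_parametric_intervalIntegral_of_continuous'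
    (μ := MeasureTheory.volume) hP _ _)

theorem angAvg_integral {P : ℝ → ℝ → ℝ} (hP : Continuous fun x : ℝ × ℝ => P x.1 x.2) (t : ℝ) :
    angAvg (fun θ => ∫ s in (0 : ℝ)..t, P s θ) = ∫ s in (0 : ℝ)..t, angAvg (P s) := by
  unfold angAvg
  rw [intervalIntegral.integral_const_mul,
    MeasureTheory.intervalIntegral_intervalIntegral_swap (F := fun θ s => P s θ)]
  refine ((hP.comp continuous_swap).continuousOn.integrableOn_compact
    (isCompact_uIcc.prod isCompact_uIcc)).mono_set (prod_mono uIoc_subset_uIcc uIoc_subset_uIcc)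

theorem continuous_time_integral {P : ℝ → ℝ → ℝ} (hP : Continuous fun x : ℝ × ℝ => P x.1 x.2) :
    Continuous fun x : ℝ × ℝ => ∫ s in (0 : ℝ)..x.1, P s x.2 :=
  (intervalIntegral.continuous_parametric_primitive_of_continuous
    (μ := MeasureTheory.volume) (f := fun φ s => P s φ) (a₀ := 0)
    (hP.comp (continuous_snd.prodMk continuous_fst))).comp (continuous_snd.prodMk continuous_fst)

/-- Positivity for the solution multiplied by `exp t`, started from `angF G`. -/
theorem pos_of_rescaled_evolution {G : ℝ → ℝ × ℝ} (hG : IsAngularProfile G)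
    {P₁ P₂ y₁ y₂ : ℝ → ℝ → ℝ}
    (hP₁ : Continuous fun x : ℝ × ℝ => P₁ x.1 x.2) (hP₂ : Continuous fun x : ℝ × ℝ => P₂ x.1 x.2)
    (hy₁ : ContinuousOn (fun x : ℝ × ℝ => y₁ x.1 x.2) (Ioi 0 ×ˢ Ioo 0 (π / 2)))
    (hy₂ : ContinuousOn (fun x : ℝ × ℝ => y₂ x.1 x.2) (Ioi 0 ×ˢ Ioo 0 (π / 2)))
    (hθ₁ : ∀ t > 0, ∀ θ ∈ Ioo 0 (π / 2), HasDerivAt (P₁ t) (y₁ t θ) θ)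
    (hθ₂ : ∀ t > 0, ∀ θ ∈ Ioo 0 (π / 2), HasDerivAt (P₂ t) (y₂ t θ) θ)
    (ht₁ : ∀ t > 0, ∀ θ ∈ Ioo 0 (π / 2), HasDerivAt (fun s => P₁ s θ)
      (P₂ t θ - 5 * P₁ t θ - 2 * sin (2 * θ) * y₁ t θ) t)
    (ht₂ : ∀ t > 0, ∀ θ ∈ Ioo 0 (π / 2), HasDerivAt (fun s => P₂ s θ)
      (130 * cos θ ^ 2 * (P₁ t θ - angAvg (P₁ t)) - 8 * P₂ t θ - 2 * sin (2 * θ) * y₂ t θ) t)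
    (h0₁ : ∀ θ ∈ Ioo 0 (π / 2), P₁ 0 θ = ((G θ).2 - (G θ).1) / 2)
    (h0₂ : ∀ θ ∈ Ioo 0 (π / 2), P₂ 0 θ = 65 * cos θ ^ 2 * ((G θ).1 - 2) - (G θ).2 / 2)
    {t : ℝ} (ht : 0 ≤ t) :
    0 < angAvg (P₁ t) - ∫ s in (0 : ℝ)..t, angAvg (P₁ s) := by
  set m : ℝ → ℝ := fun t => angAvg (P₁ t) with hm
  have hmc : Continuous m := continuous_angAvg hP₁
  set A : ℝ → ℝ := fun t => ∫ s in (0 : ℝ)..t, m s with hA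
  have hAd : ∀ t, HasDerivAt A (m t) t := fun t => (hmc.integral_hasStrictDerivAt 0 t).hasDerivAt
  have hAc : Continuous A := continuous_iff_continuousAt.2 fun t => (hAd t).continuousAt
  set K₁ : ℝ → ℝ → ℝ := fun t θ => ∫ s in (0 : ℝ)..t, P₁ s θ with hK₁
  set K₂ : ℝ → ℝ → ℝ := fun t θ => ∫ s in (0 : ℝ)..t, P₂ s θ with hK₂
  have hslice : ∀ {P : ℝ → ℝ → ℝ}, Continuous (fun x : ℝ × ℝ => P x.1 x.2) → ∀ θ,
      Continuous fun s => P s θ := fun hP θ => hP.comp (by fun_prop : Continuous fun s : ℝ => (s, θ))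
  have hKt : ∀ {P : ℝ → ℝ → ℝ}, Continuous (fun x : ℝ × ℝ => P x.1 x.2) → ∀ θ t,
      HasDerivAt (fun t => ∫ s in (0 : ℝ)..t, P s θ) (P t θ) t := fun hP θ t =>
    ((hslice hP θ).integral_hasStrictDerivAt 0 t).hasDerivAt
  have hs : ∀ x ∈ Ioo 0 (π / 2), 2 * sin (2 * x) ≠ 0 := fun x hx =>
    (mul_pos two_pos (sin_two_mul_pos hx)).ne'
  have hi : ∀ {P : ℝ → ℝ → ℝ}, Continuous (fun x : ℝ × ℝ => P x.1 x.2) → ∀ θ t,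
      IntervalIntegrable (fun s => P s θ) MeasureTheory.volume 0 t := fun hP θ t =>
    (hslice hP θ).intervalIntegrable _ _
  have hKθ₁ : ∀ t > 0, ∀ θ ∈ Ioo 0 (π / 2), ∃ k, HasDerivAt (K₁ t) k θ ∧
      2 * sin (2 * θ) * k = K₂ t θ - 5 * K₁ t θ - (P₁ t θ - P₁ 0 θ) := by
    intro t ht θ hθ
    refine ⟨_, hasDerivAt_integral_of_transport hP₁ (R := fun t θ => P₂ t θ - 5 * P₁ t θ)
      (by fun_prop) hy₁ hθ₁ ht₁ ht hθ, ?_⟩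
    rw [mul_div_cancel₀ _ (hs θ hθ), intervalIntegral.integral_sub (hi hP₂ θ t)
      ((hi hP₁ θ t).const_mul 5), intervalIntegral.integral_const_mul]
  have hKθ₂ : ∀ t > 0, ∀ θ ∈ Ioo 0 (π / 2), ∃ k, HasDerivAt (K₂ t) k θ ∧
      2 * sin (2 * θ) * k =
        130 * cos θ ^ 2 * (K₁ t θ - A t) - 8 * K₂ t θ - (P₂ t θ - P₂ 0 θ) := by
    intro t ht θ hθ
    refine ⟨_, hasDerivAt_integral_of_transport hP₂
      (R := fun t θ => 130 * cos θ ^ 2 * (P₁ t θ - m t) - 8 * P₂ t θ)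
      (by fun_prop) hy₂ hθ₂ ht₂ ht hθ, ?_⟩
    have hmi := hmc.intervalIntegrable (μ := MeasureTheory.volume) 0 t
    rw [mul_div_cancel₀ _ (hs θ hθ), intervalIntegral.integral_sub
      (((hi hP₁ θ t).sub hmi).const_mul _) ((hi hP₂ θ t).const_mul 8),
      intervalIntegral.integral_const_mul, intervalIntegral.integral_const_mul,
      intervalIntegral.integral_sub (hi hP₁ θ t) hmi]
  have hG1 : ContinuousOn (fun x : ℝ × ℝ => (G x.2).1) (Ici 0 ×ˢ Icc 0 (π / 2)) :=
    hG.continuousOn_fst.comp continuousOn_snd fun x hx => hx.2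
  have hG2 : ContinuousOn (fun x : ℝ × ℝ => (G x.2).2) (Ici 0 ×ˢ Icc 0 (π / 2)) :=
    hG.continuousOn_snd.comp continuousOn_snd fun x hx => hx.2
  have hKc₁ := continuous_time_integral hP₁
  have hKc₂ := continuous_time_integral hP₂
  have hp0 : angAvg (fun θ => ((G θ).2 - (G θ).1) / 2) = m 0 := (angAvg_congr h0₁).symm
  -- P − 5K = (∂_t − 5)K annihilates the mode e^{5t} of the local system at θ = 0. Adding 2A G makes
  -- m and A appear only as m − A, both in the forcing (−130 m + 650 A − 520 A in the cos² θ term)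
  -- and in the average (−5A + 4A).
  refine pos_of_forced_evolution hG (Y := fun t => m t - A t) (by fun_prop)
    (p := fun t θ => P₁ t θ - ((G θ).2 - (G θ).1) / 2 - 5 * K₁ t θ + 2 * A t * (G θ).1)
    (q := fun t θ => P₂ t θ - (65 * cos θ ^ 2 * ((G θ).1 - 2) - (G θ).2 / 2) - 5 * K₂ t θ +
      2 * A t * (G θ).2) ?_ ?_ ?_ ?_ ?_ ?_ ?_ ?_ t ht
  · exact ((hP₁.continuousOn.sub ((hG2.sub hG1).div_const 2)).sub
      (hKc₁.continuousOn.const_smul (5 : ℝ))).add (ContinuousOn.mul (by fun_prop) hG1)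
  · exact ((hP₂.continuousOn.sub ((ContinuousOn.mul (by fun_prop) (hG1.sub continuousOn_const)).sub
      (hG2.div_const 2))).sub
      (hKc₂.continuousOn.const_smul (5 : ℝ))).add (ContinuousOn.mul (by fun_prop) hG2)
  · intro t ht θ hθ
    obtain ⟨k, hk, hk'⟩ := hKθ₁ t ht θ hθ
    refine ⟨_, _, (((ht₁ t ht θ hθ).sub_const _).sub ((hKt hP₁ θ t).const_mul 5)).add
      (((hAd t).const_mul 2).mul_const _), (((hθ₁ t ht θ hθ).sub
      (((hG.hasDerivAt_snd hθ).sub (hG.hasDerivAt_fst hθ)).div_const 2)).sub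
      (hk.const_mul 5)).add ((hG.hasDerivAt_fst hθ).const_mul _), ?_⟩
    rw [h0₁ θ hθ] at hk'
    unfold srcFst
    linear_combination (-5) * hk' + (2 * A t + 1 / 2) * hG.eqn_fst hθ - 1 / 2 * hG.eqn_snd hθ
  · intro t ht θ hθ
    obtain ⟨k, hk, hk'⟩ := hKθ₂ t ht θ hθ
    refine ⟨_, _, (((ht₂ t ht θ hθ).sub_const _).sub ((hKt hP₂ θ t).const_mul 5)).add
      (((hAd t).const_mul 2).mul_const _), (((hθ₂ t ht θ hθ).sub
      (((((hasDerivAt_cos_sq θ).const_mul 65).mul ((hG.hasDerivAt_fst hθ).sub_const 2))).sub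
      ((hG.hasDerivAt_snd hθ).div_const 2))).sub
      (hk.const_mul 5)).add ((hG.hasDerivAt_snd hθ).const_mul _), ?_⟩
    rw [h0₂ θ hθ] at hk'
    unfold srcSnd
    linear_combination (-5) * hk' + (2 * A t + 1 / 2) * hG.eqn_snd hθ -
      65 * cos θ ^ 2 * hG.eqn_fst hθ - 65 * ((G θ).1 - 2) * two_sin_mul_deriv_cos_sq θ
  · intro θ hθ
    simp [hK₁, hA, h0₁ θ hθ]
  · intro θ hθ
    simp [hK₂, hA, h0₂ θ hθ]
  · intro t _
    have hP : ContinuousOn (P₁ t) (Icc 0 (π / 2)) :=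
      (hP₁.comp (by fun_prop : Continuous fun θ : ℝ => (t, θ))).continuousOn
    have hK : ContinuousOn (fun θ => 5 * K₁ t θ) (Icc 0 (π / 2)) :=
      (continuous_const.mul (hKc₁.comp (by fun_prop : Continuous fun θ : ℝ => (t, θ)))).continuousOn
    have hF : ContinuousOn (fun θ => ((G θ).2 - (G θ).1) / 2) (Icc 0 (π / 2)) :=
      (hG.continuousOn_snd.sub hG.continuousOn_fst).div_const 2
    have hAG : ContinuousOn (fun θ => 2 * A t * (G θ).1) (Icc 0 (π / 2)) :=
      continuousOn_const.mul hG.continuousOn_fst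
    rw [angAvg_add ((hP.fun_sub hF).fun_sub hK) hAG, angAvg_sub (hP.fun_sub hF) hK,
      angAvg_sub hP hF, angAvg_const_mul, angAvg_const_mul, hp0, hG.avg_eq, hK₁,
      angAvg_integral hP₁]
    simp only [hA, intervalIntegral.integral_same]
    ring
  · have := hG.two_le_angAvg
    rw [hp0] at this
    simpa [hA] using this

/-! ### Orbits of the two operators -/

theorem hasDerivAt_slice {f : ℝ × ℝ → ℝ} {s : Set (ℝ × ℝ)} (hs : IsOpen s)
    (hf : ContDiffOn ℝ 1 f s) {t θ : ℝ} (h : (t, θ) ∈ s) :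
    HasDerivAt (fun φ => f (t, φ)) (fderiv ℝ f (t, θ) (0, 1)) θ := by
  have h1 := ((hf.differentiableOn one_ne_zero).differentiableAt (hs.mem_nhds h)).hasFDerivAt
  exact h1.comp_hasDerivAt θ ((hasDerivAt_const θ t).prodMk (hasDerivAt_id θ))

namespace IsOrbit
variable {A : (ℝ → ℝ × ℝ) → ℝ → ℝ × ℝ} {F : ℝ → ℝ × ℝ} {u : ℝ → ℝ → ℝ × ℝ}

/-- Clamping both variables extends the orbit continuously to the whole plane without changing it on
its domain, so results for globally continuous integrands apply. -/
theorem continuous_clamp (hu : IsOrbit A F u) :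
    Continuous fun x : ℝ × ℝ => u (max 0 x.1) (max 0 (min (π / 2) x.2)) :=
  hu.continuousOn.comp_continuous (f := fun x : ℝ × ℝ => (max 0 x.1, max 0 (min (π / 2) x.2)))
    (by fun_prop) fun x => ⟨le_max_left (0 : ℝ) x.1, le_max_left (0 : ℝ) _,
      max_le (by positivity : (0 : ℝ) ≤ π / 2) (min_le_left _ _)⟩

theorem contDiffOn_fst (hu : IsOrbit A F u) :
    ContDiffOn ℝ 1 (fun x : ℝ × ℝ => (u x.1 x.2).1) (Ioi 0 ×ˢ Ioo 0 (π / 2)) :=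
  contDiff_fst.comp_contDiffOn hu.contDiffOn

theorem contDiffOn_snd (hu : IsOrbit A F u) :
    ContDiffOn ℝ 1 (fun x : ℝ × ℝ => (u x.1 x.2).2) (Ioi 0 ×ˢ Ioo 0 (π / 2)) :=
  contDiff_snd.comp_contDiffOn hu.contDiffOn

theorem angAvg_clamp (u : ℝ → ℝ → ℝ × ℝ) {t : ℝ} (ht : 0 ≤ t) :
    angAvg (fun θ => (u (max 0 t) (max 0 (min (π / 2) θ))).1) = angAvg (fun θ => (u t θ).1) :=
  angAvg_congr fun θ hθ => by rw [max_eq_right ht, clamp_eq (Ioo_subset_Icc_self hθ)]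

end IsOrbit

theorem isOpen_timeAngle : IsOpen (Ioi (0 : ℝ) ×ˢ Ioo 0 (π / 2)) := isOpen_Ioi.prod isOpen_Ioo

/-- The factor exp t lowers the diagonal coefficients 6 and 9 to 5 and 8 and turns the kernel
e^{−t+s} into a plain time integral. -/
theorem pos_of_orbit {G : ℝ → ℝ × ℝ} (hG : IsAngularProfile G) {Θ : ℝ → ℝ → ℝ × ℝ}
    (hΘ : IsOrbit opLθ (angF G) Θ) {t : ℝ} (ht : 0 ≤ t) :
    0 < exp t * angAvg (fun θ => (Θ t θ).1) -
      ∫ s in (0 : ℝ)..t, exp s * angAvg (fun θ => (Θ s θ).1) := by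
  set Q : ℝ → ℝ → ℝ × ℝ := fun t θ => Θ (max 0 t) (max 0 (min (π / 2) θ)) with hQ
  have hQc : Continuous fun x : ℝ × ℝ => Q x.1 x.2 := hΘ.continuous_clamp
  have hQeq : ∀ t, 0 ≤ t → ∀ θ ∈ Icc 0 (π / 2), Q t θ = Θ t θ := fun t ht θ hθ => by
    simp only [hQ, max_eq_right ht, clamp_eq hθ]
  have havg : ∀ t, 0 ≤ t → angAvg (fun θ => exp t * (Q t θ).1) =
      exp t * angAvg (fun θ => (Θ t θ).1) := fun t ht => by
    rw [angAvg_const_mul, IsOrbit.angAvg_clamp Θ ht]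
  have hθQ : ∀ t > 0, ∀ θ ∈ Ioo 0 (π / 2), Q t =ᶠ[nhds θ] Θ t := fun t ht θ hθ => by
    filter_upwards [Icc_mem_nhds hθ.1 hθ.2] with φ hφ using hQeq t ht.le φ hφ
  have htQ : ∀ t > 0, ∀ θ ∈ Ioo 0 (π / 2), (fun s => Q s θ) =ᶠ[nhds t] fun s => Θ s θ :=
    fun t ht θ hθ => by
      filter_upwards [Ici_mem_nhds ht] with s hs using hQeq s hs θ (Ioo_subset_Icc_self hθ)
  have hd : ∀ {f : ℝ × ℝ → ℝ}, ContDiffOn ℝ 1 f (Ioi 0 ×ˢ Ioo 0 (π / 2)) →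
      ContinuousOn (fun x : ℝ × ℝ => exp x.1 * fderiv ℝ f (x.1, x.2) (0, 1))
        (Ioi 0 ×ˢ Ioo 0 (π / 2)) := fun hf =>
    ContinuousOn.mul (by fun_prop)
      ((hf.continuousOn_fderiv_of_isOpen isOpen_timeAngle le_rfl).clm_apply continuousOn_const)
  have key := pos_of_rescaled_evolution hG (P₁ := fun t θ => exp t * (Q t θ).1)
    (P₂ := fun t θ => exp t * (Q t θ).2)
    (y₁ := fun t θ => exp t * fderiv ℝ (fun x : ℝ × ℝ => (Θ x.1 x.2).1) (t, θ) (0, 1))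
    (y₂ := fun t θ => exp t * fderiv ℝ (fun x : ℝ × ℝ => (Θ x.1 x.2).2) (t, θ) (0, 1)) (by fun_prop) (by fun_prop)
    (hd hΘ.contDiffOn_fst) (hd hΘ.contDiffOn_snd) ?_ ?_ ?_ ?_ ?_ ?_ ht
  · rw [havg t ht, intervalIntegral.integral_congr
      (g := fun s => exp s * angAvg (fun θ => (Θ s θ).1))] at key
    · exact key
    · intro s hs
      rw [uIcc_of_le ht] at hs
      exact havg s hs.1
  · intro t ht θ hθ
    refine HasDerivAt.const_mul _ ((hasDerivAt_slice isOpen_timeAngle hΘ.contDiffOn_fst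
      ⟨ht, hθ⟩).congr_of_eventuallyEq ?_)
    exact (hθQ t ht θ hθ).fun_comp Prod.fst
  · intro t ht θ hθ
    refine HasDerivAt.const_mul _ ((hasDerivAt_slice isOpen_timeAngle hΘ.contDiffOn_snd
      ⟨ht, hθ⟩).congr_of_eventuallyEq ?_)
    exact (hθQ t ht θ hθ).fun_comp Prod.snd
  · intro t ht θ hθ
    have h1 := (hΘ.eqn t ht θ hθ).congr_of_eventuallyEq (htQ t ht θ hθ)
    have h2 := (hasDerivAt_exp t).mul (hasFDerivAt_fst.comp_hasDerivAt t h1)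
    refine h2.congr_deriv ?_
    have h3 := (hasDerivAt_slice isOpen_timeAngle hΘ.contDiffOn_fst ⟨ht, hθ⟩).deriv
    simp only [opLθ, angD, h3, hQeq t ht.le θ (Ioo_subset_Icc_self hθ), Function.comp,
      ContinuousLinearMap.coe_fst', Prod.fst_neg]
    ring
  · intro t ht θ hθ
    have h1 := (hΘ.eqn t ht θ hθ).congr_of_eventuallyEq (htQ t ht θ hθ)
    have h2 := (hasDerivAt_exp t).mul (hasFDerivAt_snd.comp_hasDerivAt t h1)
    refine h2.congr_deriv ?_
    have h3 := (hasDerivAt_slice isOpen_timeAngle hΘ.contDiffOn_snd ⟨ht, hθ⟩).deriv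
    simp only [opLθ, angD, h3, hQeq t ht.le θ (Ioo_subset_Icc_self hθ), Function.comp,
      ContinuousLinearMap.coe_snd', Prod.snd_neg, havg t ht.le]
    ring
  · intro θ hθ
    simp only [hQeq 0 le_rfl θ (Ioo_subset_Icc_self hθ), hΘ.initial θ hθ, angF, angD, exp_zero]
    -- The profile equation removes the derivative from `angF G`, leaving (G₂ − G₁)/2.
    linear_combination 1 / 2 * hG.eqn_fst hθ
  · intro θ hθ
    simp only [hQeq 0 le_rfl θ (Ioo_subset_Icc_self hθ), hΘ.initial θ hθ, angF, angD, exp_zero]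
    linear_combination 1 / 2 * hG.eqn_snd hθ

/-- Adding the accumulated average times the profile turns an orbit of `opL G` into one of
`opLθ`. -/
theorem IsOrbit.add_profile {G : ℝ → ℝ × ℝ} (hG : IsAngularProfile G) {F : ℝ → ℝ × ℝ}
    {Ψ : ℝ → ℝ → ℝ × ℝ} (hΨ : IsOrbit (opL G) F Ψ) {q m : ℝ → ℝ} (hm : Continuous m)
    (hq : ∀ t, HasDerivAt q (m t) t) (hq0 : q 0 = 0)
    (hmΨ : ∀ t, 0 ≤ t → m t = angAvg (fun θ => (Ψ t θ).1)) :
    IsOrbit opLθ F (fun t θ => Ψ t θ + (q t / 2) • G θ) ∧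
      ∀ t, 0 ≤ t → angAvg (fun θ => (Ψ t θ + (q t / 2) • G θ).1) = m t + q t := by
  have hqc : ContDiff ℝ 1 q := by
    rw [contDiff_one_iff_deriv]
    exact ⟨fun t => (hq t).differentiableAt, by
      rw [show deriv q = m from funext fun t => (hq t).deriv]; exact hm⟩
  have hslice : ∀ t, 0 ≤ t → ContinuousOn (fun θ => (Ψ t θ).1) (Icc 0 (π / 2)) := fun t ht =>
    continuous_fst.comp_continuousOn
      (hΨ.continuousOn.comp (f := fun θ => (t, θ)) (by fun_prop) fun θ hθ => ⟨ht, hθ⟩)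
  have havg : ∀ t, 0 ≤ t → angAvg (fun θ => (Ψ t θ + (q t / 2) • G θ).1) = m t + q t := by
    intro t ht
    simp only [Prod.fst_add, Prod.smul_fst, smul_eq_mul]
    rw [angAvg_add (hslice t ht) (continuousOn_const.fun_mul hG.continuousOn_fst), angAvg_const_mul,
      hG.avg_eq, hmΨ t ht]
    ring
  refine ⟨⟨?_, ?_, ?_, ?_⟩, havg⟩
  · refine hΨ.continuousOn.add (ContinuousOn.fun_smul ?_ ?_)
    · exact ((hqc.continuous.comp continuous_fst).div_const 2).continuousOn
    · exact hG.continuousOn.comp continuousOn_snd fun x hx => hx.2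
  · refine hΨ.contDiffOn.add (ContDiffOn.fun_smul ?_ ?_)
    · exact ((hqc.comp contDiff_fst).div_const 2).contDiffOn
    · exact hG.contDiffOn.comp contDiff_snd.contDiffOn fun x hx => hx.2
  · intro θ hθ
    simp [hq0, hΨ.initial θ hθ]
  · intro t ht θ hθ
    refine ((hΨ.eqn t ht θ hθ).add (((hq t).div_const 2).smul_const (G θ))).congr_deriv ?_
    have h1 := hasDerivAt_slice isOpen_timeAngle hΨ.contDiffOn_fst ⟨ht, hθ⟩
    have h2 := hasDerivAt_slice isOpen_timeAngle hΨ.contDiffOn_snd ⟨ht, hθ⟩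
    have g1 := hG.hasDerivAt_fst hθ
    have g2 := hG.hasDerivAt_snd hθ
    have d1 := (h1.add (g1.const_mul (q t / 2))).deriv
    have d2 := (h2.add (g2.const_mul (q t / 2))).deriv
    have e1 := hG.eqn_fst hθ
    have e2 := hG.eqn_snd hθ
    have ha := havg t ht.le
    simp only [Prod.fst_add, Prod.smul_fst, smul_eq_mul] at ha
    have d1' : deriv (fun x => (Ψ t x).1 + q t / 2 * (G x).1) θ = _ := d1
    have d2' : deriv (fun x => (Ψ t x).2 + q t / 2 * (G x).2) θ = _ := d2
    ext
    · simp only [opL, opLθ, angD, Prod.fst_add, Prod.snd_add, Prod.smul_fst, Prod.smul_snd,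
        smul_eq_mul, Prod.fst_neg, d1', h1.deriv, ← hmΨ t ht.le]
      linear_combination q t / 2 * e1
    · simp only [opL, opLθ, angD, Prod.fst_add, Prod.snd_add, Prod.smul_fst, Prod.smul_snd,
        smul_eq_mul, Prod.snd_neg, d2', h2.deriv, ← hmΨ t ht.le, ha]
      linear_combination q t / 2 * e2

theorem lemma5p1 (G : ℝ → ℝ × ℝ) (hG : IsAngularProfile G) :
    (∀ Ψ : ℝ → ℝ → ℝ × ℝ, IsOrbit (opL G) (angF G) Ψ →
      ∀ t ∈ Set.Icc (0 : ℝ) (Real.log 4), 0 < angAvg (fun θ => (Ψ t θ).1)) ∧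
    (∀ Θ : ℝ → ℝ → ℝ × ℝ, IsOrbit opLθ (angF G) Θ →
      ∀ t ∈ Set.Icc (0 : ℝ) (Real.log 4),
        0 < angAvg (fun θ => (Θ t θ).1)
          - ∫ s in (0 : ℝ)..t, Real.exp (-t + s) * angAvg (fun θ => (Θ s θ).1)) := by
  refine ⟨fun Ψ hΨ t ht => ?_, fun Θ hΘ t ht => ?_⟩
  · set m : ℝ → ℝ := fun t => angAvg (fun θ => (Ψ (max 0 t) (max 0 (min (π / 2) θ))).1) with hm
    have hΨc := hΨ.continuous_clamp
    have hmc : Continuous m := continuous_angAvg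
      (P := fun t θ => (Ψ (max 0 t) (max 0 (min (π / 2) θ))).1) hΨc.fst
    have hmΨ : ∀ t, 0 ≤ t → m t = angAvg (fun θ => (Ψ t θ).1) := fun t ht =>
      IsOrbit.angAvg_clamp Ψ ht
    set q : ℝ → ℝ := fun t => ∫ s in (0 : ℝ)..t, m s with hq
    have hqd : ∀ t, HasDerivAt q (m t) t := fun t => (hmc.integral_hasStrictDerivAt 0 t).hasDerivAt
    have hqc : Continuous q := continuous_iff_continuousAt.2 fun t => (hqd t).continuousAt
    have hq0 : q 0 = 0 := intervalIntegral.integral_same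
    obtain ⟨hΘ, havg⟩ := hΨ.add_profile hG hmc hqd hq0 hmΨ
    have h := pos_of_orbit hG hΘ ht.1
    -- The average is m + q with q' = m, so the integrand is the derivative of exp s · q;
    -- subtracting leaves exactly exp t · m.
    have hi : ∫ s in (0 : ℝ)..t, exp s * angAvg (fun θ => (Ψ s θ + (q s / 2) • G θ).1) =
        exp t * q t := by
      rw [intervalIntegral.integral_congr (g := fun s => exp s * q s + exp s * m s),
        intervalIntegral.integral_eq_sub_of_hasDerivAt (f := fun s => exp s * q s)
          (fun s _ => (hasDerivAt_exp s).mul (hqd s))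
          ((by fun_prop : Continuous fun s => exp s * q s + exp s * m s).intervalIntegrable _ _)]
      · simp [hq0]
      · intro s hs
        rw [uIcc_of_le ht.1] at hs
        simp only [havg s hs.1]
        ring
    rw [hi, havg t ht.1, hmΨ t ht.1] at h
    refine (mul_pos_iff_of_pos_left (exp_pos t)).1 ?_
    linarith
  · have h := mul_pos (exp_pos (-t)) (pos_of_orbit hG hΘ ht.1)
    rw [mul_sub, ← mul_assoc, ← exp_add, neg_add_cancel, exp_zero, one_mul,
      ← intervalIntegral.integral_const_mul] at h
    simpa only [exp_add, mul_assoc] using h
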